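/- Let $n\ge 3$ be an integer, let $\mathbb S^n\subset\mathbb R^{n+1}$ be the unit sphere with its standard round metric and Laplace–Beltrami operator $\Delta_{\mathbb S^n}$, let $\mathbf n=(0,\dots,0,1)$ and $\mathbf s=(0,\dots,0,-1)$ be its poles, and let $\beta\in\mathbb R$. Consider the equation $$-\Delta_{\mathbb S^n}v+\beta v=v^{\frac{n+2}{n-2}}\quad\text{and}\quad v>0\quad\text{on }\mathbb S^n\setminus\{\mathbf n,\mathbf s\}.\tag{$*$}$$ (i) If $\beta<n(n-2)/4$, then every solution $v\in C^2(\mathbb S^n\setminus\{\mathbf n,\mathbf s\})$ of $(*)$ is rotationally symmetric about the line through $\mathbf n$ and $\mathbf s$, i.e. $v(A\theta)=v(\theta)$ for every orthogonal transformation $A$ of $\mathbb R^{n+1}$ with $A\mathbf n=\mathbf n$ and every $\theta\in\mathbb S^n\setminus\{\mathbf n,\mathbf s\}$. (ii) If $\beta\le 0$, then $(*)$ has no solution $v\in C^2(\mathbb S^n\setminus\{\mathbf n,\mathbf s\})$. (iii) If $(n-2)/2<\beta<n(n-2)/4$, then $(*)$ has infinitely many solutions $v\in C^2(\mathbb S^n\setminus\{\mathbf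 n,\mathbf s\})$ which have exactly two singularities, namely $\mathbf n$ and $\mathbf s$; here a point $p\in\mathbb S^n$ is a singularity of $v$ if $v(\theta)$ has no finite limit as $\theta\to p$. -/

import Mathlib

open Set Filter Topology TopologicalSpace
open scoped Manifold

/-- The unit sphere `S^n` in `ℝ^{n+1}`, with its standard smooth structure. -/
abbrev Sph (n : ℕ) : Type := Metric.sphere (0 : EuclideanSpace ℝ (Fin (n + 1))) 1

/-- The north pole `(0, …, 0, 1)`. -/
noncomputable def northPole (n : ℕ) : Sph n :=
  ⟨EuclideanSpace.single (Fin.last n) 1, by simp⟩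

/-- The south pole `(0, …, 0, -1)`. -/
noncomputable def southPole (n : ℕ) : Sph n := -northPole n

/-- The sphere without its two poles, an open submanifold of `S^n`. -/
def puncturedSphere (n : ℕ) : Opens (Sph n) :=
  ⟨{northPole n, southPole n}ᶜ, ((Set.toFinite _).isClosed).isOpen_compl⟩

/-- The extension of a function `v` on an open subset `U` of `S^n` to the open cone
`{x ≠ 0 | x / |x| ∈ U}` that is constant along rays, `x ↦ v (x / |x|)`
(and `0` outside the cone). -/
noncomputable def radialExtension {n : ℕ} {U : Opens (Sph n)} (v : U → ℝ) :
    EuclideanSpace ℝ (Fin (n + 1)) → ℝ := fun x =>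
  Function.extend (fun θ : U => ((θ : Sph n) : EuclideanSpace ℝ (Fin (n + 1)))) v 0
    (‖x‖⁻¹ • x)

/-- The Laplace–Beltrami operator `Δ_{S^n}` of the round unit sphere on functions on an open
subset: the Euclidean Laplacian of `x ↦ v (x / |x|)`, evaluated on the sphere. -/
noncomputable def sphereLaplacian {n : ℕ} {U : Opens (Sph n)} (v : U → ℝ) (θ : U) : ℝ :=
  Laplacian.laplacian (radialExtension v) ((θ : Sph n) : EuclideanSpace ℝ (Fin (n + 1)))

/-- `v ∈ C²(S^n ∖ {n, s})` is a solution of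
`-Δ_{S^n} v + β v = v^{(n+2)/(n-2)}` and `v > 0` on `S^n ∖ {n, s}`. -/
structure IsPositiveSolution (n : ℕ) (β : ℝ) (v : puncturedSphere n → ℝ) : Prop where
  contMDiff : ContMDiff (𝓡 n) 𝓘(ℝ, ℝ) 2 v
  pos : ∀ θ, 0 < v θ
  equation : ∀ θ, -sphereLaplacian v θ + β * v θ = v θ ^ (((n : ℝ) + 2) / ((n : ℝ) - 2))

/-- `v` is rotationally symmetric about the line through the two poles: it is invariant under
every orthogonal transformation of `ℝ^{n+1}` that fixes the poles. -/
def IsRotationallySymmetric {n : ℕ} (v : puncturedSphere n → ℝ) : Prop :=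
  ∀ A : EuclideanSpace ℝ (Fin (n + 1)) ≃ₗᵢ[ℝ] EuclideanSpace ℝ (Fin (n + 1)),
    A (northPole n : EuclideanSpace ℝ (Fin (n + 1))) = northPole n →
    ∀ θ θ' : puncturedSphere n,
      ((θ' : Sph n) : EuclideanSpace ℝ (Fin (n + 1))) = A ((θ : Sph n)) → v θ' = v θ

/-- The set of (non-removable) singularities of `v` in `S^n`: the points `p` at which `v` has no
finite limit, so that `v` has no continuous (let alone `C²`) extension across `p`. -/
def singularSet {n : ℕ} (v : puncturedSphere n → ℝ) : Set (Sph n) :=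
  {p | ¬ ∃ l : ℝ, Tendsto v (comap (fun θ : puncturedSphere n => (θ : Sph n)) (𝓝 p)) (𝓝 l)}

/-! Write `k = (n - 2) / 2`, `p = (n + 2) / (n - 2)`, `c = n (n - 2) / 4 - β`, and extend `v` to `V
x = ‖x‖ ^ (-k) * v (x / ‖x‖)`. The equation becomes `-Δ V = V ^ p + c ‖x‖⁻² V` on Euclidean space
minus the axis.

(i) Moving planes, carried out on the sphere. Lorentz reflections of the light cone act on functions
of degree `-k` and commute with the Laplacian (`laplacian_comp_lorentzReflection`). For `e`
orthogonal to the axis and `0 < τ < 1`, the reflection `R` in the cap `⟨e, x⟩ = τ ‖x‖` carries the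
side containing both poles into the pole-free cap and increases norms there. Since `c > 0`, the
weight `c ‖x‖⁻²` decreases, which favours `V ∘ R ≤ V`. This inequality holds for `τ` near `1`,
because `V ∘ R` is small away from the cap boundary, and it persists as `τ` decreases. The maximum
principle is needed only near the cap boundary, with an affine barrier, and near the poles, with the
barrier `-log (1 - s ^ 2)`, where `s` is the height (`reflected_le_of_compact`). Letting `τ → 0`
compares `V` with its mirror image in every hyperplane containing the axis, and such mirrors
exchange any two points of equal height.

(ii) For `β ≤ 0` the solution is strictly superharmonic. Adding a small multiple of the same barrier
forces an interior minimum, although points have zero capacity, and the equation fails at that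
minimum.

(iii) With `s = tanh t` and `v = (1 - s ^ 2) ^ (-k / 2) * w t`, zonal solutions correspond to `w'' =
(k ^ 2 - c / cosh ^ 2) w - w ^ p`. The energy does not increase as `|t|` grows, and its negative
sublevels are compact in `w > 0`. Small initial values `w 0 = a` with `w' 0 = 0` therefore give
global solutions bounded below by a positive constant, so `v` blows up at both poles. Different `a`
give different values on the equator. -/

/-! ### Second-order jets and homogeneous functions. -/

section Calculus

variable {E F G : Type*} [NormedAddCommGroup E] [NormedSpace ℝ E]
  [NormedAddCommGroup F] [NormedSpace ℝ F] [NormedAddCommGroup G] [NormedSpace ℝ G]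

/-- `f` is twice differentiable at `x`, with derivative `L` and second derivative `B`
satisfying `B b b = Q b`. -/
def HasJet2 (f : E → F) (x : E) (L : E →L[ℝ] F) (Q : E → F) : Prop :=
  ∃ (f' : E → E →L[ℝ] F) (B : E →L[ℝ] E →L[ℝ] F), (∀ᶠ y in 𝓝 x, HasFDerivAt f (f' y) y) ∧
    f' x = L ∧ HasFDerivAt f' B x ∧ ∀ b, B b b = Q b

theorem HasJet2.hasFDerivAt {f : E → F} {x : E} {L : E →L[ℝ] F} {Q : E → F}
    (h : HasJet2 f x L Q) : HasFDerivAt f L x := by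
  obtain ⟨f', B, h1, rfl, -, -⟩ := h
  exact h1.self_of_nhds

theorem HasJet2.fderiv_fderiv {f : E → F} {x : E} {L : E →L[ℝ] F} {Q : E → F}
    (h : HasJet2 f x L Q) (b : E) : fderiv ℝ (fderiv ℝ f) x b b = Q b := by
  obtain ⟨f', B, h1, rfl, h2, h3⟩ := h
  have : fderiv ℝ f =ᶠ[𝓝 x] f' := h1.mono fun y hy => hy.fderiv
  rw [this.fderiv_eq, h2.fderiv, h3]

theorem HasJet2.congr {f : E → F} {x : E} {L L' : E →L[ℝ] F} {Q Q' : E → F}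
    (h : HasJet2 f x L Q) (hL : L = L') (hQ : ∀ b, Q b = Q' b) : HasJet2 f x L' Q' := by
  subst hL
  obtain ⟨f', B, h1, h2, h3, h4⟩ := h
  exact ⟨f', B, h1, h2, h3, fun b => (h4 b).trans (hQ b)⟩

theorem HasJet2.congr_fun {f g : E → F} {x : E} {L : E →L[ℝ] F} {Q : E → F}
    (h : HasJet2 f x L Q) (hfg : g =ᶠ[𝓝 x] f) : HasJet2 g x L Q := by
  obtain ⟨f', B, h1, h2, h3, h4⟩ := h
  refine ⟨f', B, ?_, h2, h3, h4⟩
  filter_upwards [h1, hfg.eventuallyEq_nhds] with y hy hy'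
  exact hy.congr_of_eventuallyEq hy'

theorem ContDiffAt.hasJet2 {f : E → F} {x : E} (h : ContDiffAt ℝ 2 f x) :
    HasJet2 f x (fderiv ℝ f x) (fun b => fderiv ℝ (fderiv ℝ f) x b b) := by
  refine ⟨fderiv ℝ f, fderiv ℝ (fderiv ℝ f) x, ?_, rfl, ?_, fun b => rfl⟩
  · filter_upwards [h.eventually (by simp)] with y hy
    exact (hy.differentiableAt (by simp)).hasFDerivAt
  · have : ContDiffAt ℝ 1 (fderiv ℝ f) x := h.fderiv_right (m := 1) (by norm_num)
    exact (this.differentiableAt (by simp)).hasFDerivAt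

/-- Only the diagonal of the second derivative is tracked: a Laplacian needs no more, and the chain
and product rules remain explicit formulas in `b`. -/
theorem HasJet2.comp {g : F → G} {f : E → F} {x : E} {L : E →L[ℝ] F} {Q : E → F}
    {L' : F →L[ℝ] G} {Q' : F → G} (hg : HasJet2 g (f x) L' Q') (hf : HasJet2 f x L Q) :
    HasJet2 (fun y => g (f y)) x (L'.comp L) (fun b => Q' (L b) + L' (Q b)) := by
  have hf0 := hf.hasFDerivAt
  obtain ⟨f', B, h1, rfl, h3, h4⟩ := hf
  obtain ⟨g', B', k1, rfl, k3, k4⟩ := hg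
  refine ⟨fun y => (g' (f y)).comp (f' y), _, ?_, rfl,
    (k3.comp x hf0).clm_comp h3, fun b => ?_⟩
  · filter_upwards [h1, hf0.continuousAt.eventually k1] with y hy hy'
    exact hy'.comp y hy
  · simp [h4, k4, add_comm]

theorem hasJet2_clm (L : E →L[ℝ] F) (x : E) : HasJet2 L x L 0 :=
  ⟨fun _ => L, 0, Eventually.of_forall fun y => L.hasFDerivAt, rfl, hasFDerivAt_const _ _, by simp⟩

theorem hasJet2_const (c : F) (x : E) : HasJet2 (fun _ => c) x 0 0 :=
  ⟨fun _ => 0, 0, Eventually.of_forall fun y => hasFDerivAt_const _ _, rfl,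
    hasFDerivAt_const _ _, by simp⟩

theorem HasJet2.add {f g : E → F} {x : E} {L L' : E →L[ℝ] F} {Q Q' : E → F}
    (hf : HasJet2 f x L Q) (hg : HasJet2 g x L' Q') :
    HasJet2 (fun y => f y + g y) x (L + L') (fun b => Q b + Q' b) := by
  obtain ⟨f', B, h1, rfl, h3, h4⟩ := hf
  obtain ⟨g', B', k1, rfl, k3, k4⟩ := hg
  refine ⟨fun y => f' y + g' y, B + B', ?_, rfl, h3.add k3, by simp [h4, k4]⟩
  filter_upwards [h1, k1] with y hy hy'
  exact hy.add hy'

theorem HasJet2.clm_apply {f : E → F} {x : E} {L : E →L[ℝ] F} {Q : E → F} (hf : HasJet2 f x L Q)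
    (T : F →L[ℝ] G) : HasJet2 (fun y => T (f y)) x (T.comp L) (fun b => T (Q b)) :=
  ((hasJet2_clm T (f x)).comp hf).congr rfl (by simp)

theorem HasJet2.mul {f g : E → ℝ} {x : E} {L L' : E →L[ℝ] ℝ} {Q Q' : E → ℝ}
    (hf : HasJet2 f x L Q) (hg : HasJet2 g x L' Q') :
    HasJet2 (fun y => f y * g y) x (f x • L' + g x • L)
      (fun b => f x * Q' b + g x * Q b + 2 * (L b * L' b)) := by
  have hf0 := hf.hasFDerivAt
  have hg0 := hg.hasFDerivAt
  obtain ⟨f', B, h1, rfl, h3, h4⟩ := hf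
  obtain ⟨g', B', k1, rfl, k3, k4⟩ := hg
  refine ⟨fun y => f y • g' y + g y • f' y, _, ?_, rfl, (hf0.smul k3).add (hg0.smul h3), ?_⟩
  · filter_upwards [h1, k1] with y hy hy'
    exact hy.mul hy'
  · intro b
    simp [h4, k4]
    ring

theorem HasJet2.comp_real {φ φ' : ℝ → ℝ} {φ'' : ℝ} {h : E → ℝ} {x : E} {L : E →L[ℝ] ℝ} {Q : E → ℝ}
    (hh : HasJet2 h x L Q) (h1 : ∀ᶠ s in 𝓝 (h x), HasDerivAt φ (φ' s) s)
    (h2 : HasDerivAt φ' φ'' (h x)) :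
    HasJet2 (fun y => φ (h y)) x (φ' (h x) • L) (fun b => φ'' * L b ^ 2 + φ' (h x) * Q b) := by
  have : HasJet2 φ (h x) (φ' (h x) • ContinuousLinearMap.id ℝ ℝ) (fun b => φ'' * b ^ 2) := by
    refine ⟨fun s => φ' s • ContinuousLinearMap.id ℝ ℝ, _, ?_, rfl,
      (h2.smul_const (ContinuousLinearMap.id ℝ ℝ)).hasFDerivAt, fun b => ?_⟩
    · filter_upwards [h1] with s hs
      refine hs.hasFDerivAt.congr_fderiv ?_
      ext; simp
    · simp; ring
  exact (this.comp hh).congr (by ext; simp) (by simp)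

/-- A function that is homogeneous of degree `a` under positive dilations. -/
def PosHomogeneous (a : ℝ) (V : E → ℝ) : Prop :=
  ∀ r : ℝ, 0 < r → ∀ y, V (r • y) = r ^ a * V y

theorem PosHomogeneous.fderiv_self {a : ℝ} {V : E → ℝ} (hV : PosHomogeneous a V) {x : E}
    (hx : DifferentiableAt ℝ V x) : fderiv ℝ V x x = a * V x := by
  have h1 : HasDerivAt (fun r : ℝ => V (r • x)) (fderiv ℝ V x x) 1 := by
    have h : HasDerivAt (fun r : ℝ => r • x) x 1 := by
      simpa using (hasDerivAt_id (1 : ℝ)).smul_const x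
    have hx' : HasFDerivAt V (fderiv ℝ V x) ((1 : ℝ) • x) := by simpa using hx.hasFDerivAt
    exact hx'.comp_hasDerivAt (1 : ℝ) h
  have h2 : HasDerivAt (fun r : ℝ => r ^ a * V x) (a * V x) 1 := by
    simpa using (Real.hasDerivAt_rpow_const (x := 1) (p := a) (by simp)).mul_const (V x)
  refine h1.unique (h2.congr_of_eventuallyEq ?_)
  filter_upwards [lt_mem_nhds (zero_lt_one' ℝ)] with r hr using hV r hr x

/-- Euler's relation `DV(y) y = a V(y)`, differentiated at `x` in the direction `e`. -/
theorem PosHomogeneous.fderiv_fderiv_self {a : ℝ} {V : E → ℝ} (hV : PosHomogeneous a V) {x : E}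
    (hx : ContDiffAt ℝ 2 V x) (e : E) :
    fderiv ℝ (fderiv ℝ V) x e x = (a - 1) * fderiv ℝ V x e := by
  have hd : HasFDerivAt (fderiv ℝ V) (fderiv ℝ (fderiv ℝ V) x) x :=
    ((hx.fderiv_right (m := 1) (by norm_num)).differentiableAt (by simp)).hasFDerivAt
  have h1 := hd.clm_apply (hasFDerivAt_id x)
  have h2 : HasFDerivAt (fun y => a * V y) (a • fderiv ℝ V x) x :=
    (hx.differentiableAt (by simp)).hasFDerivAt.const_mul a
  have h3 := h1.unique (h2.congr_of_eventuallyEq (by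
    filter_upwards [hx.eventually (by simp)] with y hy
    exact hV.fderiv_self (hy.differentiableAt (by simp))))
  have h4 := congrArg (fun T : E →L[ℝ] ℝ => T e) h3
  simp at h4
  linarith

end Calculus

/-! ### Laplacians of zonal and homogeneous functions. -/

section LaplacianCalculus

open InnerProductSpace

variable {E : Type*} [NormedAddCommGroup E] [InnerProductSpace ℝ E] [FiniteDimensional ℝ E]

theorem HasJet2.laplacian_eq {f : E → ℝ} {x : E} {L : E →L[ℝ] ℝ} {Q : E → ℝ}
    (h : HasJet2 f x L Q) {ι : Type*} [Fintype ι] (b : OrthonormalBasis ι ℝ E) :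
    Laplacian.laplacian f x = ∑ i, Q (b i) := by
  rw [laplacian_eq_iteratedFDeriv_orthonormalBasis f b]
  exact Finset.sum_congr rfl fun i _ => by
    rw [iteratedFDeriv_two_apply]; exact h.fderiv_fderiv (b i)

/-- At a local minimum the Laplacian is nonnegative. -/
theorem IsLocalMin.laplacian_nonneg {f : E → ℝ} {x : E} (hf : ContDiffAt ℝ 2 f x)
    (h : IsLocalMin f x) : 0 ≤ Laplacian.laplacian f x := by
  rw [hf.hasJet2.laplacian_eq (stdOrthonormalBasis ℝ E)]
  refine Finset.sum_nonneg fun i _ => ?_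
  set b := stdOrthonormalBasis ℝ E i
  by_contra! hneg
  have hl : ∀ t : ℝ, HasDerivAt (fun t : ℝ => x + t • b) b t := fun t => by
    simpa using ((hasDerivAt_id t).smul_const b).const_add x
  have hc : Tendsto (fun t : ℝ => x + t • b) (𝓝 0) (𝓝 x) := by
    simpa using (hl 0).continuousAt.tendsto
  have hd : ∀ᶠ t in 𝓝 (0 : ℝ), HasDerivAt (fun t : ℝ => f (x + t • b))
      (fderiv ℝ f (x + t • b) b) t := by
    filter_upwards [hc.eventually (hf.eventually (by simp))] with t ht
    exact (ht.differentiableAt (by simp)).hasFDerivAt.comp_hasDerivAt t (hl t)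
  have hd2 : HasDerivAt (fun t : ℝ => fderiv ℝ f (x + t • b) b)
      (fderiv ℝ (fderiv ℝ f) x b b) 0 := by
    have hD : HasFDerivAt (fderiv ℝ f) (fderiv ℝ (fderiv ℝ f) x) (x + (0 : ℝ) • b) := by
      simpa using ((hf.fderiv_right (m := 1) (by norm_num)).differentiableAt (by simp)).hasFDerivAt
    have hD' : HasFDerivAt (fun y => fderiv ℝ f y b)
        ((ContinuousLinearMap.apply ℝ ℝ b).comp (fderiv ℝ (fderiv ℝ f) x)) (x + (0 : ℝ) • b) :=
      (ContinuousLinearMap.apply ℝ ℝ b).hasFDerivAt.comp _ hD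
    exact hD'.comp_hasDerivAt (0 : ℝ) (hl 0)
  have hde : deriv (fun t : ℝ => f (x + t • b)) =ᶠ[𝓝 0] fun t => fderiv ℝ f (x + t • b) b :=
    hd.mono fun t ht => ht.deriv
  have hdd : deriv (deriv (fun t : ℝ => f (x + t • b))) 0 = fderiv ℝ (fderiv ℝ f) x b b := by
    rw [hde.deriv_eq, hd2.deriv]
  have hmin : IsLocalMin (fun t : ℝ => f (x + t • b)) 0 := by
    have : ∀ᶠ t in 𝓝 (0 : ℝ), f x ≤ f (x + t • b) := hc.eventually h
    simpa [IsLocalMin, IsMinFilter] using this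
  -- A negative second derivative would make the minimum a maximum as well, so the restriction would
  -- be locally constant and its second derivative zero.
  have hmax : IsLocalMax (fun t : ℝ => f (x + t • b)) 0 :=
    isLocalMax_of_deriv_deriv_neg (by rw [hdd]; exact hneg) hmin.deriv_eq_zero
      hd.self_of_nhds.continuousAt
  have hconst : (fun t : ℝ => f (x + t • b)) =ᶠ[𝓝 0] fun _ => f (x + (0 : ℝ) • b) := by
    filter_upwards [hmin, hmax] with t h1 h2 using le_antisymm h2 h1
  have : deriv (fun t : ℝ => f (x + t • b)) =ᶠ[𝓝 0] fun _ => 0 := by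
    simpa using hconst.deriv
  rw [this.deriv_eq] at hdd
  simp at hdd
  linarith

omit [FiniteDimensional ℝ E] in
theorem hasJet2_norm {x : E} (hx : ‖x‖ = 1) :
    HasJet2 (fun y : E => ‖y‖) x (innerSL ℝ x) (fun b => ‖b‖ ^ 2 - inner ℝ x b ^ 2) := by
  have h1 : HasJet2 (fun y : E => ‖y‖ ^ 2) x (2 • innerSL ℝ x) (fun b => 2 * ‖b‖ ^ 2) := by
    refine ⟨fun y => 2 • innerSL ℝ y, 2 • innerSL ℝ, ?_, rfl, ?_, fun b => ?_⟩
    · exact Eventually.of_forall fun y => (hasStrictFDerivAt_norm_sq y).hasFDerivAt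
    · exact (innerSL ℝ).hasFDerivAt.const_smul (2 : ℕ)
    · change (2 • innerSL ℝ b) b = _
      simp
  have h2 := h1.comp_real (φ := Real.sqrt) (φ' := fun s => 1 / (2 * √s)) (φ'' := -(1 / 4)) ?_ ?_
  · refine (h2.congr ?_ fun b => ?_).congr_fun ?_
    · ext b; simp [hx]
    · simp [hx]; ring
    · exact Eventually.of_forall fun y => by simp
  · rw [hx]
    filter_upwards [lt_mem_nhds (show (0 : ℝ) < 1 ^ 2 by norm_num)] with s hs
    exact Real.hasDerivAt_sqrt hs.ne'
  · rw [hx]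
    have h3 : HasDerivAt (fun s : ℝ => 2 * √s) 1 (1 ^ 2) := by
      simpa using (Real.hasDerivAt_sqrt (show ((1 : ℝ) ^ 2) ≠ 0 by norm_num)).const_mul 2
    exact ((h3.fun_inv (by simp)).congr_deriv (by norm_num)).congr_of_eventuallyEq
      (Eventually.of_forall fun s => by simp)

omit [FiniteDimensional ℝ E] in
theorem hasJet2_norm_rpow {x : E} (hx : ‖x‖ = 1) (a : ℝ) :
    HasJet2 (fun y : E => ‖y‖ ^ a) x (a • innerSL ℝ x)
      (fun b => a * ‖b‖ ^ 2 + a * (a - 2) * inner ℝ x b ^ 2) := by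
  have h2 := (hasJet2_norm hx).comp_real (φ := fun s => s ^ a) (φ' := fun s => a * s ^ (a - 1))
    (φ'' := a * (a - 1)) ?_ ?_
  · refine h2.congr ?_ fun b => ?_
    · simp [hx]
    · simp [hx]; ring
  · rw [hx]
    filter_upwards [lt_mem_nhds (zero_lt_one' ℝ)] with s hs
    exact Real.hasDerivAt_rpow_const (Or.inl hs.ne')
  · rw [hx]
    simpa using (Real.hasDerivAt_rpow_const (x := 1) (p := a - 1) (by simp)).const_mul a

omit [FiniteDimensional ℝ E] in
theorem OrthonormalBasis.sum_inner_mul_inner' {ι : Type*} [Fintype ι] (b : OrthonormalBasis ι ℝ E)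
    (x y : E) : ∑ i, inner ℝ x (b i) * inner ℝ y (b i) = inner ℝ x y := by
  rw [← b.sum_inner_mul_inner x y]
  exact Finset.sum_congr rfl fun i _ => by rw [real_inner_comm y]

omit [FiniteDimensional ℝ E] in
theorem OrthonormalBasis.sum_inner_sq' {ι : Type*} [Fintype ι] (b : OrthonormalBasis ι ℝ E)
    (x : E) : ∑ i, inner ℝ x (b i) ^ 2 = ‖x‖ ^ 2 := by
  rw [← real_inner_self_eq_norm_sq, ← b.sum_inner_mul_inner' x x]
  exact Finset.sum_congr rfl fun i _ => sq _

/-- The spherical Laplacian of a function of `⟨x, e⟩`. -/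
theorem laplacian_zonal {x e : E} (hx : ‖x‖ = 1) (he : ‖e‖ = 1) {f f' : ℝ → ℝ} {f'' : ℝ}
    (h1 : ∀ᶠ s in 𝓝 (inner ℝ e x), HasDerivAt f (f' s) s)
    (h2 : HasDerivAt f' f'' (inner ℝ e x)) :
    Laplacian.laplacian (fun y => f (inner ℝ e y * ‖y‖ ^ (-1 : ℝ))) x =
      f'' * (1 - inner ℝ e x ^ 2) -
        (Module.finrank ℝ E - 1) * inner ℝ e x * f' (inner ℝ e x) := by
  have hh := (hasJet2_clm (innerSL ℝ e) x).mul (hasJet2_norm_rpow hx (-1))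
  have hval : (innerSL ℝ e) x * ‖x‖ ^ (-1 : ℝ) = inner ℝ e x := by simp [hx]
  have hj := hh.comp_real (φ := f) (φ' := f') (φ'' := f'') (by rwa [hval]) (by rwa [hval])
  have := hj.laplacian_eq (stdOrthonormalBasis ℝ E)
  simp only [innerSL_apply_apply] at this
  rw [this]
  set b := stdOrthonormalBasis ℝ E
  have e1 := b.sum_inner_sq' x
  have e2 := b.sum_inner_sq' e
  have e3 := b.sum_inner_mul_inner' e x
  rw [hx] at e1 ⊢
  rw [he] at e2
  set s : ℝ := inner ℝ e x
  have hcard : ∑ i, ‖b i‖ ^ 2 = (Module.finrank ℝ E : ℝ) := by simp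
  calc _ = ∑ i, (f'' * (inner ℝ e (b i) ^ 2 - 2 * s * (inner ℝ e (b i) * inner ℝ x (b i))
            + s ^ 2 * inner ℝ x (b i) ^ 2) + f' s * (-s * ‖b i‖ ^ 2
            + 3 * s * inner ℝ x (b i) ^ 2 - 2 * (inner ℝ e (b i) * inner ℝ x (b i)))) := by
        refine Finset.sum_congr rfl fun i _ => ?_
        simp
        ring
    _ = _ := by
        simp only [Finset.sum_add_distrib, ← Finset.mul_sum, Finset.sum_sub_distrib, e1, e2, e3,
          hcard]
        ring

/-- The Laplacian of the extension of degree `-k` in terms of the extension of degree `0`. -/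
theorem laplacian_norm_rpow_mul {x : E} (hx : ‖x‖ = 1) {u : E → ℝ} (hu : ContDiffAt ℝ 2 u x)
    (hu0 : PosHomogeneous 0 u) (k : ℝ) :
    Laplacian.laplacian (fun y => ‖y‖ ^ (-k) * u y) x =
      Laplacian.laplacian u x + k * (k + 1 - (Module.finrank ℝ E - 1)) * u x := by
  have hj := (hasJet2_norm_rpow hx (-k)).mul hu.hasJet2
  rw [hj.laplacian_eq (stdOrthonormalBasis ℝ E),
    hu.hasJet2.laplacian_eq (stdOrthonormalBasis ℝ E)]
  have h0 := hu0.fderiv_self (hu.differentiableAt (by simp))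
  set b := stdOrthonormalBasis ℝ E
  have e1 := b.sum_inner_sq' x
  have hcard : ∑ i, ‖b i‖ ^ 2 = (Module.finrank ℝ E : ℝ) := by simp
  -- The cross term is the radial derivative of `u`, which vanishes in degree `0`.
  have e2 : ∑ i, inner ℝ x (b i) * fderiv ℝ u x (b i) = 0 := by
    have : fderiv ℝ u x x = ∑ i, inner ℝ x (b i) * fderiv ℝ u x (b i) := by
      have hb := congrArg (fderiv ℝ u x) (b.sum_repr' x)
      rw [map_sum] at hb
      rw [← hb]
      simp [real_inner_comm]
    rw [← this, h0]; simp
  rw [hx] at e1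
  simp only [hx, Real.one_rpow, one_mul]
  calc _ = ∑ i, (fderiv ℝ (fderiv ℝ u) x (b i) (b i) + u x * (-k * ‖b i‖ ^ 2
        + k * (k + 2) * inner ℝ x (b i) ^ 2)
        - 2 * k * (inner ℝ x (b i) * fderiv ℝ u x (b i))) := by
        refine Finset.sum_congr rfl fun i _ => ?_
        simp
        ring
    _ = _ := by
        simp only [Finset.sum_add_distrib, ← Finset.mul_sum, Finset.sum_sub_distrib, e1, e2, hcard]
        ring

/-- `V` equals `r ^ (-a) * V (r • ·)`, and the chain rule produces a factor `r ^ 2`. -/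
theorem PosHomogeneous.laplacian {a : ℝ} {V : E → ℝ} (hV : PosHomogeneous a V) {x : E} {r : ℝ}
    (hr : 0 < r) (hx : ContDiffAt ℝ 2 V (r • x)) :
    Laplacian.laplacian V (r • x) = r ^ (a - 2) * Laplacian.laplacian V x := by
  set T : E →L[ℝ] E := r • ContinuousLinearMap.id ℝ E
  have hj : HasJet2 V (T x) _ _ := hx.hasJet2
  have h1 : HasJet2 (fun y => r ^ (-a) * V (T y)) x _ _ :=
    (hasJet2_const (r ^ (-a)) x).mul (hj.comp (hasJet2_clm T x))
  have h2 : (fun y => r ^ (-a) * V (T y)) = V := by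
    ext y
    have : T y = r • y := rfl
    rw [this, hV r hr, ← mul_assoc, ← Real.rpow_add hr]
    simp
  rw [h2] at h1
  rw [h1.laplacian_eq (stdOrthonormalBasis ℝ E), hx.hasJet2.laplacian_eq (stdOrthonormalBasis ℝ E)]
  have h3 : r ^ (a - 2) * (r ^ (-a) * (r * r)) = 1 := by
    rw [← Real.rpow_one r, ← Real.rpow_add hr, ← Real.rpow_one r, ← Real.rpow_mul hr.le]
    simp only [Real.rpow_one, one_mul]
    rw [← Real.rpow_add hr, ← Real.rpow_add hr]
    norm_num
  rw [Finset.mul_sum]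
  refine Finset.sum_congr rfl fun i _ => ?_
  simp [T]
  linear_combination (-(fderiv ℝ (fderiv ℝ V) (r • x) (stdOrthonormalBasis ℝ E i)
    (stdOrthonormalBasis ℝ E i))) * h3

end LaplacianCalculus

/-! ### Lorentz reflections and conformal covariance. -/

section LorentzReflection

variable {E : Type*} [NormedAddCommGroup E] [InnerProductSpace ℝ E]

/-- The action on the space part of the light cone `{(x, ‖x‖)}` of the Lorentz reflection in the
hyperplane orthogonal to `(e, τ)`. It is homogeneous of degree one, fixes the points with
`⟨e, x⟩ = τ ‖x‖`, and induces on the unit sphere the inversion in the cap `{⟨e, x⟩ = τ}`. -/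
noncomputable def lorentzReflection (e : E) (τ : ℝ) (x : E) : E :=
  x + (2 / (1 - τ ^ 2) * (τ * ‖x‖ - inner ℝ e x)) • e

theorem lorentzReflection_smul (e : E) (τ : ℝ) {r : ℝ} (hr : 0 < r) (x : E) :
    lorentzReflection e τ (r • x) = r • lorentzReflection e τ x := by
  simp only [lorentzReflection, norm_smul, inner_smul_right, Real.norm_eq_abs, abs_of_pos hr,
    smul_add, smul_smul]
  ring_nf

/-- The Lorentz reflection maps `(x, ‖x‖)` to another null vector, whose time component is the
right-hand side. The hypotheses make that component nonnegative, so it is the norm and not its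
opposite. -/
theorem norm_lorentzReflection {e : E} (he : ‖e‖ = 1) {τ : ℝ} (h0 : 0 ≤ τ) (h1 : τ < 1) {x : E}
    (hx : inner ℝ e x ≤ τ * ‖x‖) :
    ‖lorentzReflection e τ x‖ =
      ‖x‖ + τ * (2 / (1 - τ ^ 2) * (τ * ‖x‖ - inner ℝ e x)) := by
  have hτ : 0 < 1 - τ ^ 2 := by nlinarith
  have hb : 0 ≤ 2 / (1 - τ ^ 2) := by positivity
  have hψ : 0 ≤ 2 / (1 - τ ^ 2) * (τ * ‖x‖ - inner ℝ e x) :=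
    mul_nonneg hb (by linarith)
  rw [← sq_eq_sq₀ (norm_nonneg _) (by positivity), lorentzReflection, norm_add_sq_real,
    inner_smul_right, norm_smul, he, Real.norm_of_nonneg hψ, real_inner_comm]
  field_simp
  ring

theorem inner_lorentzReflection {e : E} (he : ‖e‖ = 1) {τ : ℝ} (x : E) :
    inner ℝ e (lorentzReflection e τ x) =
      inner ℝ e x + 2 / (1 - τ ^ 2) * (τ * ‖x‖ - inner ℝ e x) := by
  simp [lorentzReflection, inner_add_right, inner_smul_right, he]

/-- The map moves points only along `e`: the differential is a rank-one perturbation of the identity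
and the second derivative is a multiple of `e`. -/
theorem hasJet2_lorentzReflection (e : E) (τ : ℝ) {x : E} (hx : ‖x‖ = 1) :
    HasJet2 (lorentzReflection e τ) x
      (ContinuousLinearMap.id ℝ E +
        (innerSL ℝ ((2 / (1 - τ ^ 2)) • (τ • x - e))).smulRight e)
      (fun c => (2 / (1 - τ ^ 2) * τ * (‖c‖ ^ 2 - inner ℝ x c ^ 2)) • e) := by
  set β := 2 / (1 - τ ^ 2)
  have h1 := ((hasJet2_const (β * τ) x).mul (hasJet2_norm hx)).add
    (hasJet2_clm (-β • innerSL ℝ e) x)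
  have h2 := (hasJet2_clm (ContinuousLinearMap.id ℝ E) x).add
    (h1.clm_apply ((ContinuousLinearMap.id ℝ ℝ).smulRight e))
  refine (h2.congr ?_ fun c => ?_).congr_fun (Eventually.of_forall fun y => ?_)
  · ext c
    simp only [add_apply, ContinuousLinearMap.coe_id', id_eq,
      ContinuousLinearMap.comp_apply, ContinuousLinearMap.smulRight_apply, smul_zero,
      smul_apply, innerSL_apply_apply, inner_smul_left, inner_sub_left,
      zero_apply, smul_eq_mul, RCLike.conj_to_real]
    congr 2
    ring
  · simp
  · simp only [lorentzReflection, ContinuousLinearMap.smulRight_apply]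
    simp only [ContinuousLinearMap.coe_id', id_eq, smul_apply,
      innerSL_apply_apply, smul_eq_mul]
    congr 2
    ring

theorem contDiffAt_lorentzReflection (e : E) (τ : ℝ) {x : E} (hx : x ≠ 0) {m : ℕ∞} :
    ContDiffAt ℝ m (lorentzReflection e τ) x := by
  unfold lorentzReflection
  exact contDiffAt_id.add ((contDiffAt_const.mul ((contDiffAt_const.mul
    (contDiffAt_norm ℝ hx)).sub (contDiffAt_const.inner ℝ contDiffAt_id))).smul contDiffAt_const)

/-- Conformal covariance: functions of degree `1 - n / 2` on `ℝ^{n+1}`. -/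
theorem laplacian_comp_lorentzReflection [FiniteDimensional ℝ E] {k : ℝ}
    (hk : (Module.finrank ℝ E : ℝ) = 2 * k + 3) {V : E → ℝ} (hV : PosHomogeneous (-k) V)
    {e : E} (he : ‖e‖ = 1) {τ : ℝ} (hτ : τ ^ 2 ≠ 1) {x : E} (hx : ‖x‖ = 1)
    (hVx : ContDiffAt ℝ 2 V (lorentzReflection e τ x)) :
    Laplacian.laplacian (fun y => V (lorentzReflection e τ y)) x =
      Laplacian.laplacian V (lorentzReflection e τ x) := by
  rw [(hVx.hasJet2.comp (hasJet2_lorentzReflection e τ hx)).laplacian_eq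
    (stdOrthonormalBasis ℝ E), hVx.hasJet2.laplacian_eq (stdOrthonormalBasis ℝ E)]
  have heuler := hV.fderiv_fderiv_self hVx e
  have hsymm : ∀ a b, fderiv ℝ (fderiv ℝ V) (lorentzReflection e τ x) a b =
      fderiv ℝ (fderiv ℝ V) (lorentzReflection e τ x) b a := fun a b =>
    (hVx.isSymmSndFDerivAt (by simp)) a b
  set D := fderiv ℝ (fderiv ℝ V) (lorentzReflection e τ x)
  set D1 := fderiv ℝ V (lorentzReflection e τ x)
  set b := stdOrthonormalBasis ℝ E
  set β := 2 / (1 - τ ^ 2) with hβ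
  set g : E := β • (τ • x - e) with hg
  set s : ℝ := inner ℝ e x with hs
  have hcard : ∑ i, ‖b i‖ ^ 2 = (Module.finrank ℝ E : ℝ) := by simp
  have e1 := b.sum_inner_sq' x
  have e2 := b.sum_inner_sq' g
  have e3 : ∑ i, inner ℝ g (b i) * D e (b i) = D e g := by
    have hb := congrArg (D e) (b.sum_repr' g)
    rw [map_sum] at hb
    rw [← hb]
    simp [real_inner_comm]
  have hDx : D e x = (-k - 1) * D1 e - β * (τ - s) * D e e := by
    rw [← heuler, lorentzReflection, map_add, map_smul, hx, ← hβ, ← hs]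
    simp
  have hDg : D e g = β * (τ * D e x - D e e) := by simp [hg]
  have hgn : ‖g‖ ^ 2 = β ^ 2 * (τ ^ 2 - 2 * τ * s + 1) := by
    have hxe : inner ℝ (τ • x) e = τ * s := by rw [real_inner_comm, inner_smul_right]
    rw [hg, norm_smul, mul_pow, norm_sub_sq_real, norm_smul, hx, he, hxe, Real.norm_eq_abs,
      Real.norm_eq_abs, sq_abs, mul_one, sq_abs]
    ring
  have hββ : β * (1 - τ ^ 2) = 2 := div_mul_cancel₀ _ (sub_ne_zero.2 hτ.symm)
  -- After Euler's relation, the coefficient of `D1 e` is `β τ (-2 (k + 1) + (2 k + 2)) = 0`, where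
  -- the dimension `2 k + 3` enters, and that of `D e e` is `β (β (1 - τ ^ 2) - 2) = 0`.
  calc _ = ∑ i, (D (b i) (b i) + 2 * (inner ℝ g (b i) * D e (b i)) +
        inner ℝ g (b i) ^ 2 * D e e + β * τ * D1 e * (‖b i‖ ^ 2 - inner ℝ x (b i) ^ 2)) := by
        refine Finset.sum_congr rfl fun i _ => ?_
        simp [hsymm (b i) e]
        ring
    _ = ∑ i, D (b i) (b i) := by
        simp only [Finset.sum_add_distrib, ← Finset.mul_sum, ← Finset.sum_mul,
          Finset.sum_sub_distrib, e1, e2, e3, hcard, hDg, hDx, hgn, hx, hk]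
        linear_combination (β * D e e) * hββ

end LorentzReflection

/-! ### The punctured sphere and radial extensions. -/

section Sphere

variable {n : ℕ}

/-- The complement in `ℝ^{n+1}` of the line through the poles. -/
def offAxis (n : ℕ) : Set (EuclideanSpace ℝ (Fin (n + 1))) :=
  {x | (inner ℝ (northPole n : EuclideanSpace ℝ (Fin (n + 1))) x) ^ 2 < ‖x‖ ^ 2}

theorem isOpen_offAxis : IsOpen (offAxis n) :=
  isOpen_lt (by fun_prop) (by fun_prop)

theorem ne_zero_of_mem_offAxis {x : EuclideanSpace ℝ (Fin (n + 1))} (hx : x ∈ offAxis n) :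
    x ≠ 0 := by
  rintro rfl
  simp [offAxis] at hx

theorem smul_mem_offAxis {x : EuclideanSpace ℝ (Fin (n + 1))} {r : ℝ} (hr : 0 < r) :
    r • x ∈ offAxis n ↔ x ∈ offAxis n := by
  simp only [offAxis, Set.mem_ofPred_eq, inner_smul_right, norm_smul, mul_pow, Real.norm_eq_abs, sq_abs]
  exact mul_lt_mul_iff_right₀ (by positivity)

theorem norm_northPole : ‖(northPole n : EuclideanSpace ℝ (Fin (n + 1)))‖ = 1 :=
  norm_eq_of_mem_sphere (northPole n)

theorem mem_puncturedSphere_iff (θ : Sph n) :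
    θ ∈ puncturedSphere n ↔ (θ : EuclideanSpace ℝ (Fin (n + 1))) ∈ offAxis n := by
  have h1 : ‖(θ : EuclideanSpace ℝ (Fin (n + 1)))‖ = 1 := norm_eq_of_mem_sphere θ
  have h2 := norm_northPole (n := n)
  have habs := abs_real_inner_le_norm (northPole n : EuclideanSpace ℝ (Fin (n + 1))) θ
  rw [h1, h2, mul_one] at habs
  have hN : θ = northPole n ↔
      inner ℝ (northPole n : EuclideanSpace ℝ (Fin (n + 1))) (θ : EuclideanSpace ℝ (Fin (n + 1))) = 1 := by
    rw [inner_eq_one_iff_of_norm_eq_one h2 h1, eq_comm, Subtype.ext_iff]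
  have hS : θ = southPole n ↔
      inner ℝ (northPole n : EuclideanSpace ℝ (Fin (n + 1))) (θ : EuclideanSpace ℝ (Fin (n + 1))) = -1 := by
    rw [inner_eq_neg_one_iff_of_norm_eq_one h2 h1, southPole, Subtype.ext_iff]
    simp [eq_neg_iff_add_eq_zero, add_comm]
  change ¬ (θ = northPole n ∨ θ = southPole n) ↔ (inner ℝ
    (northPole n : EuclideanSpace ℝ (Fin (n + 1))) (θ : EuclideanSpace ℝ (Fin (n + 1)))) ^ 2 <
    ‖(θ : EuclideanSpace ℝ (Fin (n + 1)))‖ ^ 2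
  rw [h1, hN, hS, ← sq_eq_sq_iff_eq_or_eq_neg, one_pow]
  rw [← sq_le_one_iff_abs_le_one] at habs
  exact ⟨fun h => lt_of_le_of_ne habs h, fun h => h.ne⟩

/-- The radial projection of the complement of the axis to the punctured sphere. -/
noncomputable def radialProjection (x : EuclideanSpace ℝ (Fin (n + 1))) (hx : x ∈ offAxis n) :
    puncturedSphere n :=
  ⟨⟨‖x‖⁻¹ • x, by simp [norm_smul, ne_zero_of_mem_offAxis hx]⟩, by
    rw [mem_puncturedSphere_iff]
    exact (smul_mem_offAxis (inv_pos.2 (norm_pos_iff.2 (ne_zero_of_mem_offAxis hx)))).2 hx⟩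

theorem coe_injective_puncturedSphere : Function.Injective
    (fun θ : puncturedSphere n => ((θ : Sph n) : EuclideanSpace ℝ (Fin (n + 1)))) :=
  Subtype.val_injective.comp Subtype.val_injective

theorem radialExtension_eq (v : puncturedSphere n → ℝ) {x : EuclideanSpace ℝ (Fin (n + 1))}
    (hx : x ∈ offAxis n) : radialExtension v x = v (radialProjection x hx) :=
  coe_injective_puncturedSphere.extend_apply v 0 (radialProjection x hx)

theorem radialExtension_coe (v : puncturedSphere n → ℝ) (θ : puncturedSphere n) :
    radialExtension v ((θ : Sph n) : EuclideanSpace ℝ (Fin (n + 1))) = v θ := by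
  have h := coe_injective_puncturedSphere.extend_apply v 0 θ
  have h1 : ‖((θ : Sph n) : EuclideanSpace ℝ (Fin (n + 1)))‖ = 1 := norm_eq_of_mem_sphere _
  rw [radialExtension, h1, inv_one, one_smul]
  exact h

theorem posHomogeneous_radialExtension (v : puncturedSphere n → ℝ) :
    PosHomogeneous 0 (radialExtension v) := by
  intro r hr y
  rw [Real.rpow_zero, one_mul, radialExtension, radialExtension, norm_smul, Real.norm_eq_abs,
    abs_of_pos hr, smul_smul]
  congr 2
  field_simp

/-- Passage from manifold regularity to Euclidean regularity: the extension is `v` composed with the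
smooth normalisation map from the open submanifold `offAxis n` to the sphere. -/
theorem contDiffAt_radialExtension {v : puncturedSphere n → ℝ}
    (hv : ContMDiff (𝓡 n) 𝓘(ℝ, ℝ) 2 v) {x : EuclideanSpace ℝ (Fin (n + 1))}
    (hx : x ∈ offAxis n) : ContDiffAt ℝ 2 (radialExtension v) x := by
  let M : Opens (EuclideanSpace ℝ (Fin (n + 1))) := ⟨offAxis n, isOpen_offAxis⟩
  let g : M → EuclideanSpace ℝ (Fin (n + 1)) := fun y => ‖(y : EuclideanSpace ℝ (Fin (n + 1)))‖⁻¹ • (y : EuclideanSpace ℝ (Fin (n + 1)))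
  have hg' : ∀ y : M, g y ∈ Metric.sphere (0 : EuclideanSpace ℝ (Fin (n + 1))) 1 := fun y => by
    simp [g, norm_smul, ne_zero_of_mem_offAxis y.2]
  have hg : ContMDiff 𝓘(ℝ, EuclideanSpace ℝ (Fin (n + 1))) 𝓘(ℝ, EuclideanSpace ℝ (Fin (n + 1)))
      2 g := by
    intro y
    refine (contMDiffAt_subtype_iff (f := fun z : EuclideanSpace ℝ (Fin (n + 1)) =>
      ‖z‖⁻¹ • z)).2 (ContDiffAt.contMDiffAt ?_)
    have h0 := ne_zero_of_mem_offAxis y.2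
    exact ((contDiffAt_norm ℝ h0).inv (norm_ne_zero_iff.2 h0)).smul contDiffAt_id
  have := Fact.mk (@finrank_euclideanSpace_fin ℝ _ (n + 1))
  have hG := hg.codRestrict_sphere (n := n) hg'
  -- The normalisation map is corestricted to the whole sphere, so `v` is extended to it; the value
  -- `0` at the poles plays no role.
  let f : Sph n → ℝ := Function.extend Subtype.val v 0
  let X : M := ⟨x, hx⟩
  have hf : ContMDiffAt (𝓡 n) 𝓘(ℝ, ℝ) 2 f (radialProjection x hx : Sph n) := by
    have hfv : (fun θ : puncturedSphere n => f θ) = v :=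
      funext fun θ => Subtype.val_injective.extend_apply v 0 θ
    refine (contMDiffAt_subtype_iff (U := puncturedSphere n)).1 ?_
    rw [hfv]
    exact hv _
  have hcomp : ContMDiffAt 𝓘(ℝ, EuclideanSpace ℝ (Fin (n + 1))) 𝓘(ℝ, ℝ) 2
      (fun y : M => radialExtension v y) X := by
    refine (ContMDiffAt.comp X (g := f) (f := codRestrict g _ hg') hf
      (hG X)).congr_of_eventuallyEq (Eventually.of_forall fun y => ?_)
    change radialExtension v y = f (radialProjection y.1 y.2 : Sph n)
    rw [radialExtension_eq v y.2]
    exact (Subtype.val_injective.extend_apply v 0 (radialProjection y.1 y.2)).symm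
  exact (contMDiffAt_subtype_iff.1 hcomp).contDiffAt

/-- A sufficient condition for a function of the height to be `C²` on the punctured sphere. -/
theorem contMDiff_comp_height {f : ℝ → ℝ} (hf : ContDiffOn ℝ 2 f (Ioo (-1) 1)) :
    ContMDiff (𝓡 n) 𝓘(ℝ, ℝ) 2 (fun θ : puncturedSphere n =>
      f (inner ℝ (northPole n : EuclideanSpace ℝ (Fin (n + 1)))
        ((θ : Sph n) : EuclideanSpace ℝ (Fin (n + 1))))) := by
  have := Fact.mk (@finrank_euclideanSpace_fin ℝ _ (n + 1))
  intro θ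
  have h1 : ContMDiffAt (𝓡 n) 𝓘(ℝ, EuclideanSpace ℝ (Fin (n + 1))) 2
      (fun θ : puncturedSphere n => ((θ : Sph n) : EuclideanSpace ℝ (Fin (n + 1)))) θ :=
    (contMDiff_coe_sphere.comp contMDiff_subtype_val) θ
  have h2 := (mem_puncturedSphere_iff _).1 θ.2
  simp only [offAxis, Set.mem_ofPred_eq, norm_eq_of_mem_sphere, one_pow, sq_lt_one_iff_abs_lt_one,
    abs_lt] at h2
  have h3 : ContDiffAt ℝ 2 (fun x : EuclideanSpace ℝ (Fin (n + 1)) =>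
      f (inner ℝ (northPole n : EuclideanSpace ℝ (Fin (n + 1))) x)) (θ : Sph n) :=
    (hf.contDiffAt (Ioo_mem_nhds h2.1 h2.2)).comp
      (f := fun x => inner ℝ (northPole n : EuclideanSpace ℝ (Fin (n + 1))) x) _
      (contDiffAt_const.inner ℝ contDiffAt_id)
  exact ContMDiffAt.comp (g := fun x => f (inner ℝ
    (northPole n : EuclideanSpace ℝ (Fin (n + 1))) x)) θ h3.contMDiffAt h1

end Sphere

/-! ### Zonal functions in degree `0` and degree `-k`. -/

section Zonal

variable {E : Type*} [NormedAddCommGroup E] [InnerProductSpace ℝ E]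

/-- The extension of degree `0` of the function `f (⟨e, ·⟩)` on the unit sphere. -/
noncomputable def zonal (e : E) (f : ℝ → ℝ) (y : E) : ℝ := f (inner ℝ e y * ‖y‖ ^ (-1 : ℝ))

theorem zonal_of_norm_eq_one {e : E} {f : ℝ → ℝ} {y : E} (hy : ‖y‖ = 1) :
    zonal e f y = f (inner ℝ e y) := by simp [zonal, hy]

theorem posHomogeneous_zonal (e : E) (f : ℝ → ℝ) : PosHomogeneous 0 (zonal e f) := by
  intro r hr y
  simp only [zonal, Real.rpow_zero, one_mul, inner_smul_right, norm_smul, Real.norm_eq_abs,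
    abs_of_pos hr, Real.rpow_neg_one]
  congr 1
  field_simp

theorem contDiffAt_zonal {e : E} {f : ℝ → ℝ} {y : E} (hy : ‖y‖ = 1)
    (hf : ContDiffAt ℝ 2 f (inner ℝ e y)) : ContDiffAt ℝ 2 (zonal e f) y := by
  have hy0 : y ≠ 0 := by rintro rfl; simp at hy
  have h1 : ContDiffAt ℝ 2 (fun y : E => inner ℝ e y * ‖y‖ ^ (-1 : ℝ)) y :=
    (contDiffAt_const.inner ℝ contDiffAt_id).mul
      ((contDiffAt_norm ℝ hy0).rpow_const_of_ne (norm_ne_zero_iff.2 hy0))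
  exact ContDiffAt.comp (g := f) y (by simpa [hy] using hf) h1

theorem posHomogeneous_norm_rpow_mul {u : E → ℝ} (hu : PosHomogeneous 0 u) (a : ℝ) :
    PosHomogeneous a (fun y => ‖y‖ ^ a * u y) := by
  intro r hr y
  simp only [hu r hr y, norm_smul, Real.norm_eq_abs, abs_of_pos hr,
    Real.mul_rpow hr.le (norm_nonneg y), Real.rpow_zero]
  ring

theorem contDiffAt_norm_rpow_mul {u : E → ℝ} {y : E} (hy : y ≠ 0) (hu : ContDiffAt ℝ 2 u y)
    (a : ℝ) : ContDiffAt ℝ 2 (fun y => ‖y‖ ^ a * u y) y :=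
  ((contDiffAt_norm ℝ hy).rpow_const_of_ne (norm_ne_zero_iff.2 hy)).mul hu

theorem PosHomogeneous.comp_lorentzReflection {a : ℝ} {V : E → ℝ} (hV : PosHomogeneous a V)
    (e : E) (τ : ℝ) : PosHomogeneous a (fun y => V (lorentzReflection e τ y)) := by
  intro r hr y
  simp only [lorentzReflection_smul e τ hr, hV r hr]

theorem PosHomogeneous.sub {a : ℝ} {V W : E → ℝ} (hV : PosHomogeneous a V)
    (hW : PosHomogeneous a W) : PosHomogeneous a (fun y => V y - W y) := by
  intro r hr y
  simp only [hV r hr, hW r hr, mul_sub]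

theorem PosHomogeneous.const_mul {a : ℝ} {V : E → ℝ} (hV : PosHomogeneous a V) (c : ℝ) :
    PosHomogeneous a (fun y => c * V y) := by
  intro r hr y
  simp only [hV r hr]
  ring

theorem PosHomogeneous.add {a : ℝ} {V W : E → ℝ} (hV : PosHomogeneous a V)
    (hW : PosHomogeneous a W) : PosHomogeneous a (fun y => V y + W y) := by
  intro r hr y
  simp only [hV r hr, hW r hr, mul_add]

theorem PosHomogeneous.nonneg_iff {a : ℝ} {W : E → ℝ} (hW : PosHomogeneous a W) {y : E}
    (hy : y ≠ 0) : 0 ≤ W (‖y‖⁻¹ • y) ↔ 0 ≤ W y := by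
  rw [hW _ (inv_pos.2 (norm_pos_iff.2 hy))]
  have : 0 < ‖y‖⁻¹ ^ a := Real.rpow_pos_of_pos (inv_pos.2 (norm_pos_iff.2 hy)) a
  exact mul_nonneg_iff_of_pos_left this

/-- The radial projection to the unit sphere is continuous on the punctured space and fixes the
sphere. -/
theorem tendsto_normalize {x : E} (hx : ‖x‖ = 1) :
    Tendsto (fun y : E => ‖y‖⁻¹ • y) (𝓝 x) (𝓝 x) := by
  have : ContinuousAt (fun y : E => ‖y‖⁻¹ • y) x :=
    (continuous_norm.continuousAt.inv₀ (by simp [hx])).smul continuousAt_id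
  simpa [ContinuousAt, hx] using this

omit [InnerProductSpace ℝ E] in
theorem eventually_ne_zero_of_norm_eq_one {x : E} (hx : ‖x‖ = 1) : ∀ᶠ y in 𝓝 x, y ≠ 0 :=
  isOpen_ne.mem_nhds (by rintro rfl; simp at hx)

/-- A homogeneous function that vanishes at a point of the sphere and is nonnegative on the sphere
near this point has a local minimum there. -/
theorem PosHomogeneous.isLocalMin {a : ℝ} {W : E → ℝ} (hW : PosHomogeneous a W) {x : E}
    (hx : ‖x‖ = 1) (h0 : W x = 0) (h : ∀ᶠ y in 𝓝 x, ‖y‖ = 1 → 0 ≤ W y) : IsLocalMin W x := by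
  filter_upwards [(tendsto_normalize hx).eventually h, eventually_ne_zero_of_norm_eq_one hx]
    with y hy hy0
  rw [h0, ← hW.nonneg_iff hy0]
  exact hy (by simp [norm_smul, hy0])

variable [FiniteDimensional ℝ E]

/-- Barriers are taken in degree `-k`, so that they can be subtracted from `V - V ∘ R` within one
homogeneity class. -/
theorem laplacian_conformal_zonal {x e : E} (hx : ‖x‖ = 1) (he : ‖e‖ = 1) {k : ℝ}
    (hk : (Module.finrank ℝ E : ℝ) = 2 * k + 3) {f f' : ℝ → ℝ} {f'' : ℝ}
    (hf : ContDiffAt ℝ 2 f (inner ℝ e x))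
    (h1 : ∀ᶠ s in 𝓝 (inner ℝ e x), HasDerivAt f (f' s) s)
    (h2 : HasDerivAt f' f'' (inner ℝ e x)) :
    Laplacian.laplacian (fun y => ‖y‖ ^ (-k) * zonal e f y) x =
      f'' * (1 - inner ℝ e x ^ 2) - (2 * k + 2) * inner ℝ e x * f' (inner ℝ e x)
        - k * (k + 1) * f (inner ℝ e x) := by
  rw [laplacian_norm_rpow_mul hx (contDiffAt_zonal hx hf) (posHomogeneous_zonal e f)]
  have := laplacian_zonal hx he h1 h2
  change Laplacian.laplacian (zonal e f) x = _ at this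
  rw [this, zonal_of_norm_eq_one hx, hk]
  ring

end Zonal

/-! ### The logarithmic barrier at the poles. -/

section PoleBarrier

theorem one_sub_sq_pos {s : ℝ} (hs : s ∈ Ioo (-1 : ℝ) 1) : 0 < 1 - s ^ 2 := by
  nlinarith [hs.1, hs.2]

theorem hasDerivAt_one_sub_sq (s : ℝ) : HasDerivAt (fun s : ℝ => 1 - s ^ 2) (-(2 * s)) s := by
  simpa using (hasDerivAt_pow 2 s).const_sub 1

theorem hasDerivAt_neg_log_one_sub_sq {s : ℝ} (hs : s ∈ Ioo (-1 : ℝ) 1) :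
    HasDerivAt (fun s : ℝ => -Real.log (1 - s ^ 2)) (2 * s / (1 - s ^ 2)) s := by
  have h := one_sub_sq_pos hs
  refine ((hasDerivAt_one_sub_sq s).log h.ne').neg.congr_deriv ?_
  field_simp

theorem hasDerivAt_two_mul_div_one_sub_sq {s : ℝ} (hs : s ∈ Ioo (-1 : ℝ) 1) :
    HasDerivAt (fun s : ℝ => 2 * s / (1 - s ^ 2))
      (2 / (1 - s ^ 2) + 4 * s ^ 2 / (1 - s ^ 2) ^ 2) s := by
  have h := one_sub_sq_pos hs
  have h2 : HasDerivAt (fun s : ℝ => 2 * s) 2 s := by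
    simpa using (hasDerivAt_id s).const_mul 2
  refine (h2.div (hasDerivAt_one_sub_sq s) h.ne').congr_deriv ?_
  field_simp
  ring

theorem contDiffAt_neg_log_one_sub_sq {s : ℝ} (hs : s ∈ Ioo (-1 : ℝ) 1) :
    ContDiffAt ℝ 2 (fun s : ℝ => -Real.log (1 - s ^ 2)) s := by
  have h := one_sub_sq_pos hs
  exact ((contDiffAt_const.sub (contDiffAt_id.pow 2)).log h.ne').neg

variable {E : Type*} [NormedAddCommGroup E] [InnerProductSpace ℝ E] [FiniteDimensional ℝ E]

/-- In dimension greater than `3` the Laplacian tends to `-∞` at the poles while the function tends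
to `+∞`: a superharmonic barrier witnessing zero capacity. -/
theorem laplacian_zonal_pole_barrier {x e : E} (hx : ‖x‖ = 1) (he : ‖e‖ = 1)
    (hs : inner ℝ e x ∈ Ioo (-1 : ℝ) 1) :
    Laplacian.laplacian (zonal e fun s => -Real.log (1 - s ^ 2)) x =
      2 * (Module.finrank ℝ E - 2) - 2 * (Module.finrank ℝ E - 3) / (1 - inner ℝ e x ^ 2) := by
  have h := one_sub_sq_pos hs
  have := laplacian_zonal hx he (f := fun s => -Real.log (1 - s ^ 2))
    (eventually_of_mem (isOpen_Ioo.mem_nhds hs) fun s hs => hasDerivAt_neg_log_one_sub_sq hs)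
    (hasDerivAt_two_mul_div_one_sub_sq hs)
  refine this.trans ?_
  field_simp
  ring

end PoleBarrier

/-! ### Minima on the punctured sphere and nonexistence for `β ≤ 0`. -/

section Sphere

variable {n : ℕ}

theorem inner_northPole_mem_Ioo {x : EuclideanSpace ℝ (Fin (n + 1))} (hx : x ∈ offAxis n)
    (h1 : ‖x‖ = 1) :
    inner ℝ (northPole n : EuclideanSpace ℝ (Fin (n + 1))) x ∈ Ioo (-1 : ℝ) 1 := by
  simpa only [offAxis, Set.mem_ofPred_eq, h1, one_pow, sq_lt_one_iff_abs_lt_one, abs_lt,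
    mem_Ioo] using hx

/-- A continuous function on a closed subset of the sphere without the poles attains its
minimum if it is not too small near the poles. -/
theorem exists_isMinOn_of_le_near_poles {K : Set (EuclideanSpace ℝ (Fin (n + 1)))}
    (hK : IsClosed K) (hK1 : ∀ x ∈ K, ‖x‖ = 1) {f : EuclideanSpace ℝ (Fin (n + 1)) → ℝ}
    (hf : ContinuousOn f (K ∩ offAxis n)) {x₁ : EuclideanSpace ℝ (Fin (n + 1))}
    (hx₁ : x₁ ∈ K ∩ offAxis n) {δ : ℝ} (hδ : 0 < δ)
    (h : ∀ x ∈ K ∩ offAxis n,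
      1 - (inner ℝ (northPole n : EuclideanSpace ℝ (Fin (n + 1))) x) ^ 2 < δ → f x₁ ≤ f x) :
    ∃ x₀ ∈ K ∩ offAxis n, ∀ x ∈ K ∩ offAxis n, f x₀ ≤ f x := by
  set s : EuclideanSpace ℝ (Fin (n + 1)) → ℝ := fun x =>
    1 - (inner ℝ (northPole n : EuclideanSpace ℝ (Fin (n + 1))) x) ^ 2 with hs
  have hspos : ∀ x ∈ K ∩ offAxis n, 0 < s x := fun x hx =>
    one_sub_sq_pos (inner_northPole_mem_Ioo hx.2 (hK1 x hx.1))
  have hsc : Continuous s := by fun_prop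
  -- The minimum with `s x₁` places `x₁` in the compact set `C`.
  set δ' := min δ (s x₁)
  have hδ' : 0 < δ' := lt_min hδ (hspos _ hx₁)
  set C := K ∩ {x | δ' ≤ s x}
  have hsub : C ⊆ K ∩ offAxis n := fun x hx => ⟨hx.1, by
    have h1 : δ' ≤ s x := hx.2
    have h2 := hK1 x hx.1
    simp only [offAxis, Set.mem_ofPred_eq, h2]
    simp only [hs] at h1
    linarith⟩
  have hC : IsCompact C := by
    refine (isCompact_sphere (0 : EuclideanSpace ℝ (Fin (n + 1))) 1).of_isClosed_subset
      (hK.inter (isClosed_le continuous_const hsc)) fun x hx => ?_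
    simpa using hK1 x hx.1
  obtain ⟨x₀, hx₀, hmin⟩ := hC.exists_isMinOn ⟨x₁, hx₁.1, min_le_right δ (s x₁)⟩ (hf.mono hsub)
  refine ⟨x₀, hsub hx₀, fun x hx => ?_⟩
  by_cases hxδ : s x < δ'
  · exact (hmin ⟨hx₁.1, min_le_right δ (s x₁)⟩).trans (h x hx (hxδ.trans_le (min_le_left _ _)))
  · exact hmin ⟨hx.1, not_lt.1 hxδ⟩

theorem mem_offAxis_of_inner_eq_zero {x : EuclideanSpace ℝ (Fin (n + 1))} (hx : x ≠ 0)
    (h : inner ℝ (northPole n : EuclideanSpace ℝ (Fin (n + 1))) x = 0) : x ∈ offAxis n := by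
  have : 0 < ‖x‖ := norm_pos_iff.2 hx
  simp only [offAxis, Set.mem_ofPred_eq, h, zero_pow two_ne_zero]
  positivity

theorem exists_unit_inner_northPole_eq_zero (hn : 1 ≤ n) :
    ∃ e : EuclideanSpace ℝ (Fin (n + 1)), ‖e‖ = 1 ∧
      inner ℝ (northPole n : EuclideanSpace ℝ (Fin (n + 1))) e = 0 := by
  refine ⟨EuclideanSpace.single 0 1, by simp, ?_⟩
  have : (Fin.last n) ≠ 0 := by
    rw [Ne, Fin.ext_iff]; simp; omega
  simp [northPole, EuclideanSpace.inner_single_left, this]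

theorem laplacian_radialExtension_coe {β : ℝ} {v : puncturedSphere n → ℝ}
    (hv : IsPositiveSolution n β v) {x : EuclideanSpace ℝ (Fin (n + 1))} (hx : x ∈ offAxis n)
    (h1 : ‖x‖ = 1) :
    Laplacian.laplacian (radialExtension v) x = β * radialExtension v x -
      radialExtension v x ^ (((n : ℝ) + 2) / ((n : ℝ) - 2)) := by
  have h := hv.equation (radialProjection x hx)
  have hx' : ((radialProjection x hx : Sph n) : EuclideanSpace ℝ (Fin (n + 1))) = x := by
    simp [radialProjection, h1]
  rw [sphereLaplacian, hx', ← radialExtension_eq v hx] at h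
  linarith

theorem radialExtension_pos {β : ℝ} {v : puncturedSphere n → ℝ}
    (hv : IsPositiveSolution n β v) {x : EuclideanSpace ℝ (Fin (n + 1))} (hx : x ∈ offAxis n) :
    0 < radialExtension v x := by
  rw [radialExtension_eq v hx]
  exact hv.pos _

theorem exists_pos_le_radialExtension {β : ℝ} {v : puncturedSphere n → ℝ}
    (hv : IsPositiveSolution n β v) {δ : ℝ} (hδ : 0 < δ) :
    ∃ m > 0, ∀ x : EuclideanSpace ℝ (Fin (n + 1)), ‖x‖ = 1 →
      δ ≤ 1 - (inner ℝ (northPole n : EuclideanSpace ℝ (Fin (n + 1))) x) ^ 2 →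
      m ≤ radialExtension v x := by
  set C : Set (EuclideanSpace ℝ (Fin (n + 1))) := Metric.sphere 0 1 ∩
    {x | δ ≤ 1 - (inner ℝ (northPole n : EuclideanSpace ℝ (Fin (n + 1))) x) ^ 2} with hCdef
  have hC : IsCompact C := (isCompact_sphere _ _).inter_right
    (isClosed_le continuous_const (by fun_prop))
  have hsub : C ⊆ offAxis n := fun x hx => by
    have h1 : ‖x‖ = 1 := by simpa using hx.1
    have h2 := hx.2
    simp only [offAxis, Set.mem_ofPred_eq, h1] at h2 ⊢
    linarith
  have hcont : ContinuousOn (radialExtension v) C := fun x hx =>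
    (contDiffAt_radialExtension hv.contMDiff (hsub hx)).continuousAt.continuousWithinAt
  rcases C.eq_empty_or_nonempty with he | hne
  · refine ⟨1, one_pos, fun x hx hxδ => ?_⟩
    have : x ∈ C := ⟨by simpa using hx, hxδ⟩
    rw [he] at this
    exact this.elim
  · obtain ⟨x₀, hx₀, hmin⟩ := hC.exists_isMinOn hne hcont
    exact ⟨_, radialExtension_pos hv (hsub hx₀), fun x hx hxδ => hmin ⟨by simpa using hx, hxδ⟩⟩

/-- Positive solutions are strictly superharmonic for `β ≤ 0`, and the poles have capacity zero. -/
theorem not_isPositiveSolution_of_nonpos (hn : 3 ≤ n) {β : ℝ} (hβ : β ≤ 0)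
    (v : puncturedSphere n → ℝ) : ¬ IsPositiveSolution n β v := by
  intro hv
  have hn' : (3 : ℝ) ≤ n := by exact_mod_cast hn
  set N : EuclideanSpace ℝ (Fin (n + 1)) := Subtype.val (northPole n)
  set p := ((n : ℝ) + 2) / ((n : ℝ) - 2)
  have hp : 0 < p := div_pos (by linarith) (by linarith)
  -- Below this value of `1 - s ^ 2` the barrier has nonpositive Laplacian.
  have hδ : 0 < ((n : ℝ) - 2) / (n - 1) := div_pos (by linarith) (by linarith)
  obtain ⟨m, hm, hmv⟩ := exists_pos_le_radialExtension hv hδ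
  set u := radialExtension v
  have hmp : 0 < m ^ p := Real.rpow_pos_of_pos hm p
  -- Chosen so that `ε * (2 * (n - 1)) < m ^ p`: the positive part of `ε Δ G` cannot compensate `u ^
  -- p` where `u ≥ m`.
  set ε := m ^ p / (2 * n)
  have hε : 0 < ε := by positivity
  set G := zonal N (fun s => -Real.log (1 - s ^ 2))
  have hφ0 : PosHomogeneous 0 (fun y => u y + ε * G y) :=
    (posHomogeneous_radialExtension v).add ((posHomogeneous_zonal N _).const_mul ε)
  have huC : ∀ x ∈ offAxis n, ContDiffAt ℝ 2 u x :=
    fun x hx => contDiffAt_radialExtension hv.contMDiff hx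
  have hGC : ∀ x ∈ offAxis n, ‖x‖ = 1 → ContDiffAt ℝ 2 G x := fun x hx h1 =>
    contDiffAt_zonal h1 (contDiffAt_neg_log_one_sub_sq (inner_northPole_mem_Ioo hx h1))
  obtain ⟨e, he1, heN⟩ := exists_unit_inner_northPole_eq_zero (n := n) (by omega)
  have heA : e ∈ offAxis n := mem_offAxis_of_inner_eq_zero (by rintro rfl; simp at he1) heN
  obtain ⟨x₀, ⟨hx₀1, hx₀⟩, hmin⟩ := exists_isMinOn_of_le_near_poles (n := n)
    (K := Metric.sphere 0 1) Metric.isClosed_sphere (fun x hx => by simpa using hx)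
    (f := fun y => u y + ε * G y)
    (fun x hx => ((huC x hx.2).continuousAt.add (continuousAt_const.mul
      (hGC x hx.2 (by simpa using hx.1)).continuousAt)).continuousWithinAt)
    -- For `1 - s ^ 2` below this threshold, `ε * G` alone already exceeds the value of `u + ε * G`
    -- at `e`.
    (x₁ := e) ⟨by simpa using he1, heA⟩ (δ := Real.exp (-((u e + ε * G e) / ε)))
    (Real.exp_pos _) (fun x hx hxδ => by
      have h1 : ‖x‖ = 1 := by simpa using hx.1
      have h2 := one_sub_sq_pos (inner_northPole_mem_Ioo hx.2 h1)
      have h3 := (Real.log_lt_iff_lt_exp h2).2 hxδ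
      have h4 : (u e + ε * G e) / ε < G x := by
        simp only [G, zonal_of_norm_eq_one h1]
        linarith
      have h5 := radialExtension_pos hv hx.2
      rw [div_lt_iff₀ hε] at h4
      change u e + ε * G e ≤ u x + ε * G x
      have h6 : 0 < u x := h5
      linarith)
  have h1 : ‖x₀‖ = 1 := by simpa using hx₀1
  have hs := inner_northPole_mem_Ioo hx₀ h1
  have hs' := one_sub_sq_pos hs
  have hloc : IsLocalMin (fun y => u y + ε * G y) x₀ := by
    filter_upwards [isOpen_offAxis.mem_nhds hx₀] with y hy
    have hy0 := ne_zero_of_mem_offAxis hy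
    have hyn : 0 < ‖y‖⁻¹ := inv_pos.2 (norm_pos_iff.2 hy0)
    have h2 := hmin (‖y‖⁻¹ • y) ⟨by simp [norm_smul, hy0], (smul_mem_offAxis hyn).2 hy⟩
    have h3 := hφ0 _ hyn y
    simp only [Real.rpow_zero, one_mul] at h3
    exact h2.trans_eq h3
  have hεG : ContDiffAt ℝ 2 (ε • G) x₀ := contDiffAt_const.smul (hGC x₀ hx₀ h1)
  have hlap : 0 ≤ Laplacian.laplacian (fun y => u y + ε * G y) x₀ :=
    hloc.laplacian_nonneg ((huC x₀ hx₀).add hεG)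
  have hsum : Laplacian.laplacian (fun y => u y + ε * G y) x₀ =
      Laplacian.laplacian u x₀ + ε * Laplacian.laplacian G x₀ := by
    have h2 := (huC x₀ hx₀).laplacian_add hεG
    rw [InnerProductSpace.laplacian_smul ε (hGC x₀ hx₀ h1)] at h2
    exact h2
  have hlG : Laplacian.laplacian G x₀ = _ := laplacian_zonal_pole_barrier h1 norm_northPole hs
  rw [hsum, hlG, laplacian_radialExtension_coe hv hx₀ h1, finrank_euclideanSpace_fin] at hlap
  push_cast at hlap
  set σ : ℝ := 1 - inner ℝ N x₀ ^ 2
  have hu0 : 0 < u x₀ := radialExtension_pos hv hx₀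
  have hup : 0 < u x₀ ^ p := Real.rpow_pos_of_pos hu0 p
  have hβu : β * u x₀ ≤ 0 := mul_nonpos_of_nonpos_of_nonneg hβ hu0.le
  -- The terms in `u` are negative, so the barrier term must be positive at the minimum. This keeps
  -- `x₀` away from the poles, where the lower bound `m` applies.
  have hpos : 0 < ε * (2 * ((n : ℝ) - 1) - 2 * ((n : ℝ) - 2) / σ) := by
    have : (n : ℝ) + 1 - 2 = n - 1 := by ring
    have h' : (n : ℝ) + 1 - 3 = n - 2 := by ring
    rw [this, h'] at hlap
    linarith
  have hσ : ((n : ℝ) - 2) / (n - 1) ≤ σ := by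
    have h2 := pos_of_mul_pos_right hpos hε.le
    have h3 : 2 * ((n : ℝ) - 2) / σ < 2 * ((n : ℝ) - 1) := by linarith
    rw [div_lt_iff₀ hs'] at h3
    rw [div_le_iff₀ (by linarith)]
    linarith
  have hmu : m ^ p ≤ u x₀ ^ p := Real.rpow_le_rpow hm.le (hmv x₀ h1 hσ) hp.le
  have h7 : 0 ≤ ε * (2 * ((n : ℝ) - 2) / σ) := by
    have : 0 ≤ (n : ℝ) - 2 := by linarith
    positivity
  have h8 : ε * (2 * n) = m ^ p := div_mul_cancel₀ _ (by positivity)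
  have h9 : (n : ℝ) + 1 - 2 = n - 1 := by ring
  have h10 : (n : ℝ) + 1 - 3 = n - 2 := by ring
  rw [h9, h10] at hlap
  nlinarith

end Sphere

/-! ### The conformal equation and the comparison principle. -/

section MovingPlanes

variable {n : ℕ}

/-- The positive solutions of degree `-k` off the axis of `-Δ V = V ^ p + c |x|⁻² V`. -/
structure IsConformalSolution (n : ℕ) (k p c : ℝ) (V : EuclideanSpace ℝ (Fin (n + 1)) → ℝ) :
    Prop where
  homogeneous : PosHomogeneous (-k) V
  contDiffAt : ∀ x ∈ offAxis n, ContDiffAt ℝ 2 V x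
  pos : ∀ x ∈ offAxis n, 0 < V x
  equation : ∀ x ∈ offAxis n, -Laplacian.laplacian V x = V x ^ p + c * ‖x‖ ^ (-2 : ℝ) * V x

/-- Since `k * p = k + 2`, all terms are homogeneous of degree `-k - 2`, so it suffices to look at
unit vectors. Passing to degree `-k` contributes `-n (n - 2) / 4` to the zeroth-order coefficient.
-/
theorem IsPositiveSolution.isConformalSolution (hn : 3 ≤ n) {β : ℝ} {v : puncturedSphere n → ℝ}
    (hv : IsPositiveSolution n β v) :
    IsConformalSolution n (((n : ℝ) - 2) / 2) (((n : ℝ) + 2) / ((n : ℝ) - 2))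
      ((n : ℝ) * ((n : ℝ) - 2) / 4 - β)
      (fun x => ‖x‖ ^ (-(((n : ℝ) - 2) / 2)) * radialExtension v x) := by
  have hn' : (3 : ℝ) ≤ n := by exact_mod_cast hn
  set k := ((n : ℝ) - 2) / 2 with hk
  set p := ((n : ℝ) + 2) / ((n : ℝ) - 2) with hp
  have hkp : k * p = k + 2 := by
    have : (n : ℝ) - 2 ≠ 0 := by linarith
    rw [hk, hp]; field_simp; ring
  have hpos : ∀ x ∈ offAxis n, 0 < ‖x‖ := fun x hx => norm_pos_iff.2 (ne_zero_of_mem_offAxis hx)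
  have hhom : PosHomogeneous (-k) (fun x => ‖x‖ ^ (-k) * radialExtension v x) :=
    posHomogeneous_norm_rpow_mul (posHomogeneous_radialExtension v) (-k)
  have hC : ∀ x ∈ offAxis n, ContDiffAt ℝ 2 (fun x => ‖x‖ ^ (-k) * radialExtension v x) x :=
    fun x hx => contDiffAt_norm_rpow_mul (ne_zero_of_mem_offAxis hx)
      (contDiffAt_radialExtension hv.contMDiff hx) _
  refine ⟨hhom, hC, fun x hx => mul_pos (Real.rpow_pos_of_pos (hpos x hx) _)
    (radialExtension_pos hv hx), fun x hx => ?_⟩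
  have hr := hpos x hx
  set r := ‖x‖ with hrdef
  obtain ⟨y, hy⟩ : ∃ y, y = r⁻¹ • x := ⟨_, rfl⟩
  have hxy : x = r • y := by rw [hy, smul_smul, mul_inv_cancel₀ hr.ne', one_smul]
  have hy1 : ‖y‖ = 1 := by
    rw [hy, norm_smul, norm_inv, ← hrdef, Real.norm_of_nonneg hr.le, inv_mul_cancel₀ hr.ne']
  have hyA : y ∈ offAxis n := by rw [hy]; exact (smul_mem_offAxis (inv_pos.2 hr)).2 hx
  have huy : radialExtension v x = radialExtension v y := by
    rw [hxy, posHomogeneous_radialExtension v r hr, Real.rpow_zero, one_mul]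
  have hlap : Laplacian.laplacian (fun x => ‖x‖ ^ (-k) * radialExtension v x) x =
      r ^ (-k - 2) * (β * radialExtension v y - radialExtension v y ^ p -
        (n : ℝ) * ((n : ℝ) - 2) / 4 * radialExtension v y) := by
    rw [hxy, hhom.laplacian hr (by rw [← hxy]; exact hC x hx),
      laplacian_norm_rpow_mul hy1 (contDiffAt_radialExtension hv.contMDiff hyA)
        (posHomogeneous_radialExtension v), laplacian_radialExtension_coe hv hyA hy1,
      finrank_euclideanSpace_fin]
    push_cast
    rw [hk]
    ring
  have hu0 := radialExtension_pos hv hyA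
  have h1 : (r ^ (-k) * radialExtension v y) ^ p = r ^ (-k - 2) * radialExtension v y ^ p := by
    rw [Real.mul_rpow (Real.rpow_nonneg hr.le _) hu0.le, ← Real.rpow_mul hr.le]
    congr 2
    linarith
  have h2 : r ^ (-2 : ℝ) * r ^ (-k) = r ^ (-k - 2) := by
    rw [← Real.rpow_add hr]; congr 1; ring
  rw [hlap, huy, h1]
  linear_combination (-(((n : ℝ) * (n - 2) / 4 - β) * radialExtension v y)) * h2

theorem inner_sq_add_inner_sq_le {E : Type*} [NormedAddCommGroup E] [InnerProductSpace ℝ E]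
    {a e : E} (ha : ‖a‖ = 1) (he : ‖e‖ = 1) (hae : inner ℝ a e = 0) (x : E) :
    inner ℝ a x ^ 2 + inner ℝ e x ^ 2 ≤ ‖x‖ ^ 2 := by
  have h : 0 ≤ ‖x - inner ℝ a x • a - inner ℝ e x • e‖ ^ 2 := by positivity
  rw [norm_sub_sq_real, norm_sub_sq_real, inner_sub_left, norm_smul, norm_smul, ha, he,
    inner_smul_right, inner_smul_right, inner_smul_right, inner_smul_left, hae,
    real_inner_comm a x, real_inner_comm e x] at h
  simp only [Real.norm_eq_abs, mul_one, sq_abs, mul_zero, sub_zero] at h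
  linarith

/-- The reflection reverses the sign of `⟨e, x⟩ - τ ‖x‖`. -/
theorem lorentzReflection_cap {E : Type*} [NormedAddCommGroup E] [InnerProductSpace ℝ E] {e : E}
    (he : ‖e‖ = 1) {τ : ℝ} (h0 : 0 ≤ τ) (h1 : τ < 1) {x : E} (hx : inner ℝ e x ≤ τ * ‖x‖) :
    τ * ‖lorentzReflection e τ x‖ ≤ inner ℝ e (lorentzReflection e τ x) := by
  have hτ : 1 - τ ^ 2 ≠ 0 := by nlinarith
  rw [norm_lorentzReflection he h0 h1 hx, inner_lorentzReflection he]
  have : 2 / (1 - τ ^ 2) * (1 - τ ^ 2) = 2 := div_mul_cancel₀ _ hτ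
  nlinarith

theorem norm_le_norm_lorentzReflection {E : Type*} [NormedAddCommGroup E] [InnerProductSpace ℝ E]
    {e : E} (he : ‖e‖ = 1) {τ : ℝ} (h0 : 0 ≤ τ) (h1 : τ < 1) {x : E}
    (hx : inner ℝ e x ≤ τ * ‖x‖) : ‖x‖ ≤ ‖lorentzReflection e τ x‖ := by
  rw [norm_lorentzReflection he h0 h1 hx]
  have hτ : 0 < 1 - τ ^ 2 := by nlinarith
  have h2 : 0 ≤ τ * ‖x‖ - inner ℝ e x := by linarith
  have : 0 ≤ τ * (2 / (1 - τ ^ 2) * (τ * ‖x‖ - inner ℝ e x)) := by positivity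
  linarith

theorem norm_lt_norm_lorentzReflection {E : Type*} [NormedAddCommGroup E] [InnerProductSpace ℝ E]
    {e : E} (he : ‖e‖ = 1) {τ : ℝ} (h0 : 0 < τ) (h1 : τ < 1) {x : E}
    (hx : inner ℝ e x < τ * ‖x‖) : ‖x‖ < ‖lorentzReflection e τ x‖ := by
  rw [norm_lorentzReflection he h0.le h1 hx.le]
  have hτ : 0 < 1 - τ ^ 2 := by nlinarith
  have h2 : 0 < τ * ‖x‖ - inner ℝ e x := by linarith
  have : 0 < τ * (2 / (1 - τ ^ 2) * (τ * ‖x‖ - inner ℝ e x)) := by positivity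
  linarith

theorem mem_offAxis_of_inner_ne_zero {e : EuclideanSpace ℝ (Fin (n + 1))} (he : ‖e‖ = 1)
    (heN : inner ℝ (northPole n : EuclideanSpace ℝ (Fin (n + 1))) e = 0)
    {x : EuclideanSpace ℝ (Fin (n + 1))} (hx : inner ℝ e x ≠ 0) : x ∈ offAxis n := by
  have h1 := inner_sq_add_inner_sq_le norm_northPole he heN x
  have h2 : 0 < inner ℝ e x ^ 2 := by positivity
  simp only [offAxis, Set.mem_ofPred_eq]
  linarith

/-- For `τ > 0` the image has positive `e`-component, hence misses the axis even if `x` is a pole.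
The reflected function is thus regular where `V` may be singular. -/
theorem lorentzReflection_mem_offAxis {e : EuclideanSpace ℝ (Fin (n + 1))} (he : ‖e‖ = 1)
    (heN : inner ℝ (northPole n : EuclideanSpace ℝ (Fin (n + 1))) e = 0) {τ : ℝ} (h0 : 0 < τ)
    (h1 : τ < 1) {x : EuclideanSpace ℝ (Fin (n + 1))} (hx0 : x ≠ 0)
    (hx : inner ℝ e x ≤ τ * ‖x‖) : lorentzReflection e τ x ∈ offAxis n := by
  refine mem_offAxis_of_inner_ne_zero he heN (ne_of_gt ?_)
  have h2 := lorentzReflection_cap he h0.le h1 hx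
  have h3 := norm_le_norm_lorentzReflection he h0.le h1 hx
  have h4 : 0 < ‖x‖ := norm_pos_iff.2 hx0
  exact (mul_pos h0 (h4.trans_le h3)).trans_le h2

theorem lorentzReflection_eq_self {E : Type*} [NormedAddCommGroup E] [InnerProductSpace ℝ E]
    {e : E} {τ : ℝ} {x : E} (hx : inner ℝ e x = τ * ‖x‖) : lorentzReflection e τ x = x := by
  simp [lorentzReflection, hx]

variable {k p c : ℝ} {V : EuclideanSpace ℝ (Fin (n + 1)) → ℝ}
  {e : EuclideanSpace ℝ (Fin (n + 1))}

/-- A bound for the reflected function, uniform for `τ₁ ≤ τ < 1`. -/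
theorem IsConformalSolution.exists_reflected_le (hV : IsConformalSolution n k p c V)
    (he : ‖e‖ = 1) (heN : inner ℝ (northPole n : EuclideanSpace ℝ (Fin (n + 1))) e = 0)
    {τ₁ : ℝ} (hτ₁ : 0 < τ₁) :
    ∃ A > 0, ∀ τ, τ₁ ≤ τ → τ < 1 → ∀ x : EuclideanSpace ℝ (Fin (n + 1)), ‖x‖ = 1 →
      inner ℝ e x ≤ τ →
      V (lorentzReflection e τ x) ≤ A * ‖lorentzReflection e τ x‖ ^ (-k) := by
  -- This single compact cap contains the normalised images for all `τ ≥ τ₁`.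
  set C : Set (EuclideanSpace ℝ (Fin (n + 1))) := Metric.sphere 0 1 ∩ {x | τ₁ ≤ inner ℝ e x}
  have hC : IsCompact C := (isCompact_sphere _ _).inter_right
    (isClosed_le continuous_const (by fun_prop))
  have hsub : C ⊆ offAxis n := fun x hx =>
    mem_offAxis_of_inner_ne_zero he heN (ne_of_gt (hτ₁.trans_le hx.2))
  have hcont : ContinuousOn V C := fun x hx =>
    (hV.contDiffAt x (hsub hx)).continuousAt.continuousWithinAt
  obtain ⟨A, hA⟩ := (hC.image_of_continuousOn hcont).bddAbove
  refine ⟨max A 1, by positivity, fun τ hτ hτ1 x hx1 hx => ?_⟩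
  have hx' : inner ℝ e x ≤ τ * ‖x‖ := by rwa [hx1, mul_one]
  have h0 : 0 < τ := hτ₁.trans_le hτ
  have hcap := lorentzReflection_cap he h0.le hτ1 hx'
  have hnorm := norm_le_norm_lorentzReflection he h0.le hτ1 hx'
  set y := lorentzReflection e τ x
  have hy : 0 < ‖y‖ := by linarith
  have hyV : V y = ‖y‖ ^ (-k) * V (‖y‖⁻¹ • y) := by
    rw [← hV.homogeneous _ hy, smul_smul, mul_inv_cancel₀ hy.ne', one_smul]
  have hmem : ‖y‖⁻¹ • y ∈ C := by
    refine ⟨by simp [norm_smul, hy.ne'], ?_⟩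
    change τ₁ ≤ inner ℝ e (‖y‖⁻¹ • y)
    rw [inner_smul_right, inv_mul_eq_div, le_div_iff₀ hy]
    exact (mul_le_mul_of_nonneg_right hτ hy.le).trans hcap
  rw [hyV, mul_comm]
  exact mul_le_mul_of_nonneg_right ((hA (mem_image_of_mem V hmem)).trans (le_max_left _ _))
    (Real.rpow_nonneg hy.le _)

/-- Convexity of `t ^ p`, as Bernoulli's inequality at `a / b - 1`. In the comparison `b` is the
reflected value, which has a uniform bound. -/
theorem rpow_sub_rpow_ge {a b p : ℝ} (ha : 0 < a) (hb : 0 < b) (hp : 1 ≤ p) :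
    p * b ^ (p - 1) * (a - b) ≤ a ^ p - b ^ p := by
  have h := one_add_mul_self_le_rpow_one_add (s := a / b - 1) (by
    have : 0 < a / b := by positivity
    linarith) hp
  have h1 : 1 + (a / b - 1) = a / b := by ring
  rw [h1, Real.div_rpow ha.le hb.le, le_div_iff₀ (Real.rpow_pos_of_pos hb p)] at h
  have h2 : b ^ p = b ^ (p - 1) * b := by
    rw [← Real.rpow_add_one hb.ne']; congr 1; ring
  have h3 : a / b * b = a := div_mul_cancel₀ _ hb.ne'
  have h4 : (1 + p * (a / b - 1)) * b ^ p = b ^ p + p * b ^ (p - 1) * (a - b) := by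
    rw [h2]
    linear_combination (p * b ^ (p - 1)) * h3
  linarith

theorem IsConformalSolution.contDiffAt_reflected (hV : IsConformalSolution n k p c V)
    (he : ‖e‖ = 1) (heN : inner ℝ (northPole n : EuclideanSpace ℝ (Fin (n + 1))) e = 0)
    {τ : ℝ} (h0 : 0 < τ) (h1 : τ < 1) {x : EuclideanSpace ℝ (Fin (n + 1))} (hx0 : x ≠ 0)
    (hx : inner ℝ e x ≤ τ * ‖x‖) :
    ContDiffAt ℝ 2 (fun y => V (lorentzReflection e τ y)) x :=
  ContDiffAt.comp (g := V) x (hV.contDiffAt _ (lorentzReflection_mem_offAxis he heN h0 h1 hx0 hx))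
    (contDiffAt_lorentzReflection e τ (m := 2) hx0)

theorem IsConformalSolution.contDiffAt_diff (hV : IsConformalSolution n k p c V)
    (he : ‖e‖ = 1) (heN : inner ℝ (northPole n : EuclideanSpace ℝ (Fin (n + 1))) e = 0)
    {τ : ℝ} (h0 : 0 < τ) (h1 : τ < 1) {x : EuclideanSpace ℝ (Fin (n + 1))} (hx0 : x ∈ offAxis n)
    (hx : inner ℝ e x ≤ τ * ‖x‖) :
    ContDiffAt ℝ 2 (fun y => V y - V (lorentzReflection e τ y)) x :=
  (hV.contDiffAt x hx0).sub
    (hV.contDiffAt_reflected he heN h0 h1 (ne_zero_of_mem_offAxis hx0) hx)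

theorem IsConformalSolution.laplacian_diff (hV : IsConformalSolution n k p c V)
    (hk : (n : ℝ) = 2 * k + 2)
    (he : ‖e‖ = 1) (heN : inner ℝ (northPole n : EuclideanSpace ℝ (Fin (n + 1))) e = 0)
    {τ : ℝ} (h0 : 0 < τ) (h1 : τ < 1) {x : EuclideanSpace ℝ (Fin (n + 1))} (hx0 : x ∈ offAxis n)
    (hx1 : ‖x‖ = 1) (hx : inner ℝ e x ≤ τ) :
    -Laplacian.laplacian (fun y => V y - V (lorentzReflection e τ y)) x =
      V x ^ p - V (lorentzReflection e τ x) ^ p +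
        c * (V x - ‖lorentzReflection e τ x‖ ^ (-2 : ℝ) * V (lorentzReflection e τ x)) := by
  have hx' : inner ℝ e x ≤ τ * ‖x‖ := by rwa [hx1, mul_one]
  have hR := lorentzReflection_mem_offAxis he heN h0 h1 (ne_zero_of_mem_offAxis hx0) hx'
  have hsub : Laplacian.laplacian (fun y => V y - V (lorentzReflection e τ y)) x =
      Laplacian.laplacian V x - Laplacian.laplacian (fun y => V (lorentzReflection e τ y)) x :=
    (hV.contDiffAt x hx0).laplacian_sub
      (hV.contDiffAt_reflected he heN h0 h1 (ne_zero_of_mem_offAxis hx0) hx')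
  have hcov := laplacian_comp_lorentzReflection (k := k) (by
    rw [finrank_euclideanSpace_fin]; push_cast; linarith) hV.homogeneous he (τ := τ)
    (by nlinarith) hx1 (hV.contDiffAt _ hR)
  have e1 := hV.equation x hx0
  have e2 := hV.equation _ hR
  rw [hx1, Real.one_rpow] at e1
  rw [hsub, hcov]
  linear_combination e1 - e2

/-- The comparison of the solution with its reflection is preserved at a point where the quotient
of the difference by a strict supersolution of the linearised equation is minimal. -/
theorem IsConformalSolution.not_isLocalMin_quotient (hV : IsConformalSolution n k p c V)
    (hk : (n : ℝ) = 2 * k + 2) (hp : 1 ≤ p) (hc : 0 ≤ c)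
    (he : ‖e‖ = 1) (heN : inner ℝ (northPole n : EuclideanSpace ℝ (Fin (n + 1))) e = 0)
    {τ : ℝ} (h0 : 0 < τ) (h1 : τ < 1) {x : EuclideanSpace ℝ (Fin (n + 1))} (hx0 : x ∈ offAxis n)
    (hx1 : ‖x‖ = 1) (hx : inner ℝ e x ≤ τ) {A : ℝ}
    (hA : V (lorentzReflection e τ x) ≤ A)
    (hW : V x - V (lorentzReflection e τ x) < 0)
    {a : EuclideanSpace ℝ (Fin (n + 1))} (ha : ‖a‖ = 1) {f f' : ℝ → ℝ} {f'' : ℝ}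
    (hf0 : 0 < f (inner ℝ a x))
    (hf : ContDiffAt ℝ 2 f (inner ℝ a x))
    (hf1 : ∀ᶠ s in 𝓝 (inner ℝ a x), HasDerivAt f (f' s) s)
    (hf2 : HasDerivAt f' f'' (inner ℝ a x))
    (hsuper : f'' * (1 - inner ℝ a x ^ 2) - n * inner ℝ a x * f' (inner ℝ a x)
      - k * (k + 1) * f (inner ℝ a x) < -(p * A ^ (p - 1) + c) * f (inner ℝ a x)) :
    ¬ ∀ᶠ y in 𝓝 x, ‖y‖ = 1 → (V x - V (lorentzReflection e τ x)) / f (inner ℝ a x) *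
      f (inner ℝ a y) ≤ V y - V (lorentzReflection e τ y) := by
  intro hmin
  have hx' : inner ℝ e x ≤ τ * ‖x‖ := by rwa [hx1, mul_one]
  have hxne := ne_zero_of_mem_offAxis hx0
  have hR := lorentzReflection_mem_offAxis he heN h0 h1 hxne hx'
  have hnorm := norm_le_norm_lorentzReflection he h0.le h1 hx'
  rw [hx1] at hnorm
  have hVR := hV.pos _ hR
  have hVx := hV.pos _ hx0
  have hlapW := hV.laplacian_diff hk he heN h0 h1 hx0 hx1 hx
  set W : EuclideanSpace ℝ (Fin (n + 1)) → ℝ := fun y => V y - V (lorentzReflection e τ y) with hWd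
  set m := (V x - V (lorentzReflection e τ x)) / f (inner ℝ a x) with hm
  have hmneg : m < 0 := div_neg_of_neg_of_pos hW hf0
  set g : EuclideanSpace ℝ (Fin (n + 1)) → ℝ := fun y => ‖y‖ ^ (-k) * zonal a f y with hg
  have hghom : PosHomogeneous (-k) g := posHomogeneous_norm_rpow_mul (posHomogeneous_zonal a f) _
  have hWhom : PosHomogeneous (-k) W :=
    hV.homogeneous.sub (hV.homogeneous.comp_lorentzReflection e τ)
  have hg1 : ∀ y, ‖y‖ = 1 → g y = f (inner ℝ a y) := fun y hy => by
    simp [hg, zonal_of_norm_eq_one hy, hy]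
  have hgC : ContDiffAt ℝ 2 g x := contDiffAt_norm_rpow_mul hxne (contDiffAt_zonal hx1 hf) _
  have hWC : ContDiffAt ℝ 2 W x := hV.contDiffAt_diff he heN h0 h1 hx0 hx'
  have hloc : IsLocalMin (fun y => W y - m * g y) x := by
    refine (hWhom.sub (hghom.const_mul m)).isLocalMin hx1 ?_ ?_
    · rw [hg1 x hx1, hm, div_mul_cancel₀ _ hf0.ne']
      exact sub_self _
    · filter_upwards [hmin] with y hy hy1
      rw [hg1 y hy1]
      exact sub_nonneg.2 (hy hy1)
  have hmg : ContDiffAt ℝ 2 (m • g) x := contDiffAt_const.smul hgC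
  have hlap : 0 ≤ Laplacian.laplacian (fun y => W y - m * g y) x :=
    hloc.laplacian_nonneg (hWC.sub hmg)
  have hsplit : Laplacian.laplacian (fun y => W y - m * g y) x =
      Laplacian.laplacian W x - m * Laplacian.laplacian g x := by
    have h2 := hWC.laplacian_sub hmg
    rw [InnerProductSpace.laplacian_smul m hgC] at h2
    exact h2
  have hlg : Laplacian.laplacian g x = _ := laplacian_conformal_zonal hx1 ha (k := k) (by
    rw [finrank_euclideanSpace_fin]; push_cast; linarith) hf hf1 hf2
  rw [← hk] at hlg
  rw [← hlg] at hsuper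
  have hmg2 := mul_lt_mul_of_neg_left hsuper hmneg
  have hmf : m * f (inner ℝ a x) = V x - V (lorentzReflection e τ x) :=
    div_mul_cancel₀ _ hf0.ne'
  -- Let `C = p * A ^ (p - 1) + c`. As `W x < 0` and `‖R x‖ ≥ 1`, the equation gives `-Δ W ≥ C * W`
  -- at `x`. Minimality and the strict supersolution, multiplied by `m < 0`, give `-Δ W < C * W`.
  have hconv := rpow_sub_rpow_ge hVx hVR hp
  set b := V (lorentzReflection e τ x)
  have hbA : b ^ (p - 1) ≤ A ^ (p - 1) := Real.rpow_le_rpow hVR.le hA (by linarith)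
  have hR2 : ‖lorentzReflection e τ x‖ ^ (-2 : ℝ) ≤ 1 :=
    Real.rpow_le_one_of_one_le_of_nonpos hnorm (by norm_num)
  have h5 : c * (V x - b) ≤ c * (V x - ‖lorentzReflection e τ x‖ ^ (-2 : ℝ) * b) := by
    refine mul_le_mul_of_nonneg_left ?_ hc
    nlinarith
  have h6 : p * A ^ (p - 1) * (V x - b) ≤ p * b ^ (p - 1) * (V x - b) := by
    refine mul_le_mul_of_nonpos_right ?_ hW.le
    exact mul_le_mul_of_nonneg_left hbA (by linarith)
  have h7 : m * (-(p * A ^ (p - 1) + c) * f (inner ℝ a x)) =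
      -(p * A ^ (p - 1) + c) * (V x - b) := by rw [← hmf]; ring
  linarith

end MovingPlanes

/-! ### Maximum principles near the cap boundary and near the poles. -/

section MovingPlanes

variable {n : ℕ} {k p c : ℝ} {V : EuclideanSpace ℝ (Fin (n + 1)) → ℝ}
  {e : EuclideanSpace ℝ (Fin (n + 1))}

/-- Maximum principle in a narrow band next to the reflecting cap. -/
theorem IsConformalSolution.reflected_le_of_band (hV : IsConformalSolution n k p c V)
    (hk : (n : ℝ) = 2 * k + 2) (hk0 : 0 < k) (hp : 1 ≤ p) (hc : 0 ≤ c)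
    (he : ‖e‖ = 1) (heN : inner ℝ (northPole n : EuclideanSpace ℝ (Fin (n + 1))) e = 0)
    {τ₁ : ℝ} (hτ₁ : 0 < τ₁) {A : ℝ} (hA0 : 0 < A)
    (hA : ∀ τ, τ₁ ≤ τ → τ < 1 → ∀ x : EuclideanSpace ℝ (Fin (n + 1)), ‖x‖ = 1 →
      inner ℝ e x ≤ τ → V (lorentzReflection e τ x) ≤ A) :
    ∃ δ > 0, δ ≤ τ₁ / 2 ∧ ∀ τ, τ₁ ≤ τ → τ < 1 →
      (∀ x ∈ offAxis n, ‖x‖ = 1 → inner ℝ e x ≤ τ - δ → V (lorentzReflection e τ x) ≤ V x) →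
      ∀ x ∈ offAxis n, ‖x‖ = 1 → inner ℝ e x ≤ τ → V (lorentzReflection e τ x) ≤ V x := by
  set C := p * A ^ (p - 1) + c with hCdef
  have hC : 0 ≤ C := by positivity
  -- On the band `s ≥ τ₁ / 2`, so the slope term satisfies `n * s * M ≥ C + 1` and dominates `C * f
  -- ≤ C`. The width `1 / (2 * M)` keeps the affine barrier in `[1/2, 1]`.
  set M := 2 * (C + 1) / τ₁ with hM
  have hM0 : 0 < M := by positivity
  have hMτ : M * τ₁ = 2 * (C + 1) := div_mul_cancel₀ _ hτ₁.ne'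
  have hδM : 1 / (2 * M) * (2 * M) = 1 := div_mul_cancel₀ _ (by positivity)
  have hδ0 : 0 < 1 / (2 * M) := by positivity
  have hδ : 1 / (2 * M) ≤ τ₁ / 2 := by
    rw [div_le_iff₀ (by positivity)]
    nlinarith
  refine ⟨1 / (2 * M), hδ0, hδ, fun τ hτ hτ1 hgood x₁ hx₁ hx₁1 hx₁τ => ?_⟩
  set δ := 1 / (2 * M)
  have h0 : 0 < τ := hτ₁.trans_le hτ
  by_contra! hneg
  set f : ℝ → ℝ := fun s => 1 - M * (τ - s) with hf
  set W : EuclideanSpace ℝ (Fin (n + 1)) → ℝ := fun y => V y - V (lorentzReflection e τ y) with hW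
  set K : Set (EuclideanSpace ℝ (Fin (n + 1))) := Metric.sphere 0 1 ∩
    ({x | τ - δ ≤ inner ℝ e x} ∩ {x | inner ℝ e x ≤ τ}) with hK
  have hmemK : ∀ y, y ∈ K ↔ ‖y‖ = 1 ∧ τ - δ ≤ inner ℝ e y ∧ inner ℝ e y ≤ τ := fun y => by
    simp [hK]
  have hKc : IsCompact K := (isCompact_sphere _ _).inter_right
    ((isClosed_le continuous_const (by fun_prop)).inter
      (isClosed_le (by fun_prop) continuous_const))
  have hKA : ∀ y ∈ K, y ∈ offAxis n := fun y hy => by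
    have h2 := ((hmemK y).1 hy).2.1
    exact mem_offAxis_of_inner_ne_zero he heN (ne_of_gt (by linarith))
  have hfK : ∀ y ∈ K, 1 / 2 ≤ f (inner ℝ e y) ∧ f (inner ℝ e y) ≤ 1 := fun y hy => by
    obtain ⟨-, h2, h3⟩ := (hmemK y).1 hy
    simp only [hf]
    constructor <;> nlinarith
  have hWC : ∀ y ∈ K, ContDiffAt ℝ 2 W y := fun y hy => by
    obtain ⟨h1, -, h3⟩ := (hmemK y).1 hy
    exact hV.contDiffAt_diff he heN h0 hτ1 (hKA y hy) (by rwa [h1, mul_one])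
  have hx₁K : x₁ ∈ K := by
    refine (hmemK _).2 ⟨hx₁1, ?_, hx₁τ⟩
    by_contra! h
    exact absurd (hgood x₁ hx₁ hx₁1 h.le) (not_le.2 hneg)
  obtain ⟨x, hxK, hmin⟩ := hKc.exists_isMinOn (f := fun y => W y / f (inner ℝ e y)) ⟨x₁, hx₁K⟩
    (fun y hy => ((hWC y hy).continuousAt.div (by fun_prop)
      (by have := (hfK y hy).1; linarith)).continuousWithinAt)
  obtain ⟨hx1, hxl, hxr⟩ := (hmemK x).1 hxK
  have hfx := hfK x hxK
  have hfx0 : 0 < f (inner ℝ e x) := by linarith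
  have hWx : W x < 0 := by
    have h2 : W x / f (inner ℝ e x) ≤ W x₁ / f (inner ℝ e x₁) := hmin hx₁K
    have h3 : W x₁ / f (inner ℝ e x₁) < 0 :=
      div_neg_of_neg_of_pos (sub_neg.2 hneg) (by linarith [(hfK x₁ hx₁K).1])
    by_contra! h4
    exact absurd (div_nonneg h4 hfx0.le) (not_le.2 (h2.trans_lt h3))
  -- The negative minimum is interior: `W ≥ 0` on the inner edge by hypothesis, and `W = 0` on the
  -- cap boundary, which the reflection fixes.
  have hxl' : τ - δ < inner ℝ e x := by
    refine lt_of_le_of_ne hxl fun h => ?_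
    have := hgood x (hKA x hxK) hx1 h.ge
    exact absurd hWx (not_lt.2 (sub_nonneg.2 this))
  have hxr' : inner ℝ e x < τ := by
    refine lt_of_le_of_ne hxr fun h => ?_
    have h2 : W x = 0 := by
      simp only [hW]
      rw [lorentzReflection_eq_self (by rw [h, hx1, mul_one]), sub_self]
    exact hWx.ne h2
  refine hV.not_isLocalMin_quotient hk hp hc he heN h0 hτ1 (hKA x hxK) hx1 hxr
    (hA τ hτ hτ1 x hx1 hxr) hWx he (f := f) (f' := fun _ => M) (f'' := 0) hfx0 ?_ ?_ ?_ ?_ ?_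
  · simp only [hf]; fun_prop
  · refine Eventually.of_forall fun s => ?_
    simpa using (((hasDerivAt_id s).const_sub τ).const_mul M).const_sub 1
  · exact hasDerivAt_const _ _
  · have h2 : τ₁ / 2 ≤ inner ℝ e x := by linarith
    have h3 : C + 1 ≤ M * inner ℝ e x := by nlinarith
    have h4 : C + 1 ≤ n * (M * inner ℝ e x) := by nlinarith
    have h5 : 0 < k * (k + 1) * f (inner ℝ e x) := by positivity
    have h6 : C * f (inner ℝ e x) ≤ C := mul_le_of_le_one_right hC hfx.2
    nlinarith
  · have hopen : IsOpen ({y : EuclideanSpace ℝ (Fin (n + 1)) | τ - δ < inner ℝ e y} ∩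
        {y | inner ℝ e y < τ}) :=
      (isOpen_lt continuous_const (by fun_prop)).inter (isOpen_lt (by fun_prop) continuous_const)
    filter_upwards [hopen.mem_nhds ⟨hxl', hxr'⟩] with y hy hy1
    have hyK : y ∈ K := (hmemK y).2 ⟨hy1, le_of_lt hy.1, le_of_lt hy.2⟩
    exact (le_div_iff₀ (by linarith [(hfK y hyK).1])).1 (hmin hyK)

/-- After multiplication by `σ` the left side tends to `0`, because `σ log σ → 0`. -/
theorem exists_pole_barrier_bound {C a : ℝ} (ha : 0 < a) :
    ∃ δ > 0, ∀ σ, 0 < σ → σ ≤ δ → (2 * a + 2) + C * (-Real.log σ) < 2 * a / σ := by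
  have hcont : Continuous fun σ : ℝ => (2 * a + 2) * σ + C * (-(σ * Real.log σ)) := by
    have := Real.continuous_mul_log
    fun_prop
  have h1 : ∀ᶠ σ in 𝓝 (0 : ℝ), (2 * a + 2) * σ + C * (-(σ * Real.log σ)) < 2 * a :=
    hcont.continuousAt.eventually_lt continuousAt_const (by simpa using ha)
  obtain ⟨δ, hδ, h⟩ := Metric.eventually_nhds_iff.1 h1
  refine ⟨δ / 2, by positivity, fun σ hσ hσδ => ?_⟩
  have h2 := h (y := σ) (by rw [Real.dist_eq, sub_zero, abs_of_pos hσ]; linarith)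
  rw [lt_div_iff₀ hσ]
  nlinarith

/-- Maximum principle near the poles, where the solution may be singular. -/
theorem IsConformalSolution.reflected_le_of_poles (hV : IsConformalSolution n k p c V)
    (hk : (n : ℝ) = 2 * k + 2) (hk0 : 0 < k) (hp : 1 ≤ p) (hc : 0 ≤ c)
    (he : ‖e‖ = 1) (heN : inner ℝ (northPole n : EuclideanSpace ℝ (Fin (n + 1))) e = 0)
    {τ₁ : ℝ} (hτ₁ : 0 < τ₁) {A : ℝ} (hA0 : 0 < A)
    (hA : ∀ τ, τ₁ ≤ τ → τ < 1 → ∀ x : EuclideanSpace ℝ (Fin (n + 1)), ‖x‖ = 1 →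
      inner ℝ e x ≤ τ → V (lorentzReflection e τ x) ≤ A) :
    ∃ δ > 0, ∀ τ, τ₁ ≤ τ → τ < 1 → ∀ τ' ≤ τ, τ₁ / 2 ≤ τ' →
      (∀ x ∈ offAxis n, ‖x‖ = 1 → inner ℝ e x ≤ τ' →
        δ ≤ 1 - (inner ℝ (northPole n : EuclideanSpace ℝ (Fin (n + 1))) x) ^ 2 →
        V (lorentzReflection e τ x) ≤ V x) →
      ∀ x ∈ offAxis n, ‖x‖ = 1 → inner ℝ e x ≤ τ' → V (lorentzReflection e τ x) ≤ V x := by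
  set C := p * A ^ (p - 1) + c with hCdef
  have hC : 0 ≤ C := by positivity
  obtain ⟨δ₀, hδ₀, hbar⟩ := exists_pole_barrier_bound (C := C) (show 0 < 2 * k by linarith)
  set N : EuclideanSpace ℝ (Fin (n + 1)) := Subtype.val (northPole n) with hN
  have hN1 : ‖N‖ = 1 := norm_northPole
  -- `δ₀` makes the barrier a strict supersolution, `(τ₁ / 2) ^ 2` confines the polar neighbourhoods
  -- to `⟨e, x⟩ ≤ τ₁ / 2` by Bessel's inequality, and `1 / 2` makes the logarithmic barrier
  -- positive.
  refine ⟨min δ₀ (min ((τ₁ / 2) ^ 2) (1 / 2)), by positivity,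
    fun τ hτ hτ1 τ' hτ' hττ' hgood x₁ hx₁ hx₁1 hx₁τ => ?_⟩
  set δ := min δ₀ (min ((τ₁ / 2) ^ 2) (1 / 2))
  have hδ1 : δ ≤ δ₀ := min_le_left _ _
  have hδ2 : δ ≤ (τ₁ / 2) ^ 2 := (min_le_right _ _).trans (min_le_left _ _)
  have hδ3 : δ ≤ 1 / 2 := (min_le_right _ _).trans (min_le_right _ _)
  have h0 : 0 < τ := hτ₁.trans_le hτ
  by_contra! hneg
  set f : ℝ → ℝ := fun s => -Real.log (1 - s ^ 2) with hf
  set W : EuclideanSpace ℝ (Fin (n + 1)) → ℝ := fun y => V y - V (lorentzReflection e τ y) with hW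
  set K : Set (EuclideanSpace ℝ (Fin (n + 1))) := Metric.sphere 0 1 ∩
    {x | 1 - inner ℝ N x ^ 2 ≤ δ} with hK
  have hmemK : ∀ y, y ∈ K ↔ ‖y‖ = 1 ∧ 1 - inner ℝ N y ^ 2 ≤ δ := fun y => by
    simp [hK]
  have hKc : IsClosed K := Metric.isClosed_sphere.inter
    (isClosed_le (by fun_prop) continuous_const)
  have hKe : ∀ y ∈ K, inner ℝ e y ≤ τ' := fun y hy => by
    obtain ⟨h1, h2⟩ := (hmemK y).1 hy
    have h3 := inner_sq_add_inner_sq_le hN1 he heN y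
    rw [h1] at h3
    exact (abs_le_of_sq_le_sq' (by nlinarith) (by linarith)).2.trans hττ'
  have hfK : ∀ y ∈ K ∩ offAxis n, 0 < f (inner ℝ N y) := fun y hy => by
    obtain ⟨h1, h2⟩ := (hmemK y).1 hy.1
    have h3 := one_sub_sq_pos (inner_northPole_mem_Ioo hy.2 h1)
    exact neg_pos.2 (Real.log_neg h3 (by linarith))
  have hfC : ∀ y ∈ K ∩ offAxis n, ContDiffAt ℝ 2 f (inner ℝ N y) := fun y hy =>
    contDiffAt_neg_log_one_sub_sq (inner_northPole_mem_Ioo hy.2 ((hmemK y).1 hy.1).1)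
  have hWC : ∀ y ∈ K ∩ offAxis n, ContDiffAt ℝ 2 W y := fun y hy =>
    hV.contDiffAt_diff he heN h0 hτ1 hy.2
      (by rw [((hmemK y).1 hy.1).1, mul_one]; exact (hKe y hy.1).trans hτ')
  have hx₁K : x₁ ∈ K ∩ offAxis n := by
    refine ⟨(hmemK _).2 ⟨hx₁1, ?_⟩, hx₁⟩
    by_contra! h
    exact absurd (hgood x₁ hx₁ hx₁1 hx₁τ h.le) (not_le.2 hneg)
  have hWneg : W x₁ < 0 := sub_neg.2 hneg
  set m := W x₁ / f (inner ℝ N x₁) with hm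
  have hm0 : m < 0 := div_neg_of_neg_of_pos hWneg (hfK x₁ hx₁K)
  obtain ⟨x, hxK, hmin⟩ := exists_isMinOn_of_le_near_poles hKc (fun y hy => ((hmemK y).1 hy).1)
    (f := fun y => W y / f (inner ℝ N y))
    (fun y hy => ((hWC y hy).continuousAt.div ((hfC y hy).continuousAt.comp
      (f := fun y => inner ℝ N y) (by fun_prop)) (hfK y hy).ne').continuousWithinAt)
    -- Here `m < 0`, so below this threshold `m * f < -A ≤ W`: near the poles the quotient exceeds
    -- its value at `x₁`.
    hx₁K (δ := Real.exp (A / m)) (Real.exp_pos _) (fun y hy hyδ => by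
      have h1 := ((hmemK y).1 hy.1).1
      have h2 := one_sub_sq_pos (inner_northPole_mem_Ioo hy.2 h1)
      have h3 := (Real.log_lt_iff_lt_exp h2).2 hyδ
      have h4 : A / m * m = A := div_mul_cancel₀ _ hm0.ne
      have h5 : f (inner ℝ N y) = -Real.log (1 - inner ℝ N y ^ 2) := rfl
      change m ≤ W y / f (inner ℝ N y)
      rw [le_div_iff₀ (hfK y hy), h5]
      have h6 : -A ≤ W y := by
        have h7 := hA τ hτ hτ1 y h1 ((hKe y hy.1).trans hτ')
        have h8 := hV.pos y hy.2
        simp only [hW]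
        linarith
      nlinarith)
  obtain ⟨hx1, hxδ⟩ := (hmemK x).1 hxK.1
  have hfx := hfK x hxK
  have hWx : W x < 0 := by
    have h2 : W x / f (inner ℝ N x) ≤ m := hmin x₁ hx₁K
    by_contra! h4
    exact absurd (div_nonneg h4 hfx.le) (not_le.2 (h2.trans_lt hm0))
  have hxδ' : 1 - inner ℝ N x ^ 2 < δ := by
    refine lt_of_le_of_ne hxδ fun h => ?_
    have := hgood x hxK.2 hx1 (hKe x hxK.1) h.ge
    exact absurd hWx (not_lt.2 (sub_nonneg.2 this))
  have hs := inner_northPole_mem_Ioo hxK.2 hx1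
  have hσ := one_sub_sq_pos hs
  refine hV.not_isLocalMin_quotient hk hp hc he heN h0 hτ1 hxK.2 hx1 ((hKe x hxK.1).trans hτ')
    (hA τ hτ hτ1 x hx1 ((hKe x hxK.1).trans hτ')) hWx hN1 (f := f)
    (f' := fun s => 2 * s / (1 - s ^ 2)) hfx (hfC x hxK)
    (eventually_of_mem (isOpen_Ioo.mem_nhds hs) fun s hs => hasDerivAt_neg_log_one_sub_sq hs)
    (hasDerivAt_two_mul_div_one_sub_sq hs) ?_ ?_
  · have h2 := hbar _ hσ (hxδ.trans hδ1)
    have h5 : 0 < k * (k + 1) * f (inner ℝ N x) := by positivity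
    have h6 : f (inner ℝ N x) = -Real.log (1 - inner ℝ N x ^ 2) := rfl
    rw [← h6] at h2
    have h7 : (2 / (1 - inner ℝ N x ^ 2) + 4 * inner ℝ N x ^ 2 / (1 - inner ℝ N x ^ 2) ^ 2) *
        (1 - inner ℝ N x ^ 2) - n * inner ℝ N x * (2 * inner ℝ N x / (1 - inner ℝ N x ^ 2)) =
        2 * (2 * k) + 2 - 2 * (2 * k) / (1 - inner ℝ N x ^ 2) := by
      have h8 : 1 - inner ℝ N x ^ 2 ≠ 0 := hσ.ne'
      rw [hk]
      field_simp
      ring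
    rw [h7]
    linarith
  · have hopen : IsOpen {y : EuclideanSpace ℝ (Fin (n + 1)) | 1 - inner ℝ N y ^ 2 < δ} :=
      isOpen_lt (by fun_prop) continuous_const
    filter_upwards [hopen.mem_nhds hxδ', isOpen_offAxis.mem_nhds hxK.2] with y hy hyA hy1
    have hyK : y ∈ K ∩ offAxis n := ⟨(hmemK y).2 ⟨hy1, le_of_lt hy⟩, hyA⟩
    exact (le_div_iff₀ (hfK y hyK)).1 (hmin y hyK)

/-- The comparison with the reflection only has to be checked on a compact set that avoids the
reflecting cap and the poles. -/
theorem IsConformalSolution.reflected_le_of_compact (hV : IsConformalSolution n k p c V)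
    (hk : (n : ℝ) = 2 * k + 2) (hk0 : 0 < k) (hp : 1 ≤ p) (hc : 0 ≤ c)
    (he : ‖e‖ = 1) (heN : inner ℝ (northPole n : EuclideanSpace ℝ (Fin (n + 1))) e = 0)
    {τ₁ : ℝ} (hτ₁ : 0 < τ₁) :
    ∃ δ > 0, ∀ τ, τ₁ ≤ τ → τ < 1 →
      (∀ x ∈ offAxis n, ‖x‖ = 1 → inner ℝ e x ≤ τ - δ →
        δ ≤ 1 - (inner ℝ (northPole n : EuclideanSpace ℝ (Fin (n + 1))) x) ^ 2 →
        V (lorentzReflection e τ x) ≤ V x) →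
      ∀ x ∈ offAxis n, ‖x‖ = 1 → inner ℝ e x ≤ τ → V (lorentzReflection e τ x) ≤ V x := by
  obtain ⟨A, hA0, hA⟩ := hV.exists_reflected_le he heN hτ₁
  have hA' : ∀ τ, τ₁ ≤ τ → τ < 1 → ∀ x : EuclideanSpace ℝ (Fin (n + 1)), ‖x‖ = 1 →
      inner ℝ e x ≤ τ → V (lorentzReflection e τ x) ≤ A := fun τ hτ hτ1 x hx1 hx => by
    refine (hA τ hτ hτ1 x hx1 hx).trans (mul_le_of_le_one_right hA0.le ?_)
    have := norm_le_norm_lorentzReflection he (hτ₁.trans_le hτ).le hτ1 (x := x)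
      (by rwa [hx1, mul_one])
    rw [hx1] at this
    exact Real.rpow_le_one_of_one_le_of_nonpos this (by linarith)
  obtain ⟨δ, hδ, hδτ, hband⟩ := hV.reflected_le_of_band hk hk0 hp hc he heN hτ₁ hA0 hA'
  obtain ⟨δ', hδ', hpole⟩ := hV.reflected_le_of_poles hk hk0 hp hc he heN hτ₁ hA0 hA'
  -- The polar estimate is used outside the band, at `τ' = τ - δ`; the bound `δ ≤ τ₁ / 2` ensures
  -- `τ' ≥ τ₁ / 2`.
  refine ⟨min δ δ', by positivity, fun τ hτ hτ1 hgood => hband τ hτ hτ1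
    (hpole τ hτ hτ1 (τ - δ) (by linarith) (by linarith) fun x hx hx1 hxτ hxδ => ?_)⟩
  exact hgood x hx hx1 (hxτ.trans (by linarith [min_le_left δ δ'])) ((min_le_right δ δ').trans hxδ)

end MovingPlanes

/-! ### The moving plane procedure and rotational symmetry. -/

section MovingPlanes

variable {n : ℕ} {k p c : ℝ} {V : EuclideanSpace ℝ (Fin (n + 1)) → ℝ}
  {e : EuclideanSpace ℝ (Fin (n + 1))}

theorem continuousAt_lorentzReflection_uncurry {E : Type*} [NormedAddCommGroup E]
    [InnerProductSpace ℝ E] (e : E) {τ : ℝ} (hτ : τ ^ 2 ≠ 1) (x : E) :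
    ContinuousAt (fun z : ℝ × E => lorentzReflection e z.1 z.2) (τ, x) := by
  unfold lorentzReflection
  have h : (1 : ℝ) - τ ^ 2 ≠ 0 := sub_ne_zero.2 hτ.symm
  have h1 : ContinuousAt (fun z : ℝ × E => 2 / (1 - z.1 ^ 2)) (τ, x) :=
    continuousAt_const.div (by fun_prop) h
  exact continuousAt_snd.add ((h1.mul (by fun_prop)).smul continuousAt_const)

/-- Strict comparison in the open cap. -/
theorem IsConformalSolution.reflected_lt (hV : IsConformalSolution n k p c V)
    (hk : (n : ℝ) = 2 * k + 2) (hc : 0 < c)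
    (he : ‖e‖ = 1) (heN : inner ℝ (northPole n : EuclideanSpace ℝ (Fin (n + 1))) e = 0)
    {τ : ℝ} (h0 : 0 < τ) (h1 : τ < 1)
    (hgood : ∀ x ∈ offAxis n, ‖x‖ = 1 → inner ℝ e x ≤ τ → V (lorentzReflection e τ x) ≤ V x)
    {x : EuclideanSpace ℝ (Fin (n + 1))} (hx : x ∈ offAxis n) (hx1 : ‖x‖ = 1)
    (hxτ : inner ℝ e x < τ) : V (lorentzReflection e τ x) < V x := by
  refine lt_of_le_of_ne (hgood x hx hx1 hxτ.le) fun heq => ?_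
  have hx' : inner ℝ e x < τ * ‖x‖ := by rwa [hx1, mul_one]
  have hxne := ne_zero_of_mem_offAxis hx
  have hVR := hV.pos _ (lorentzReflection_mem_offAxis he heN h0 h1 hxne hx'.le)
  have hnorm := norm_lt_norm_lorentzReflection he h0 h1 hx'
  rw [hx1] at hnorm
  have hlapW := hV.laplacian_diff hk he heN h0 h1 hx hx1 hxτ.le
  have hloc : IsLocalMin (fun y => V y - V (lorentzReflection e τ y)) x := by
    refine (hV.homogeneous.sub (hV.homogeneous.comp_lorentzReflection e τ)).isLocalMin hx1
      (by simp [heq]) ?_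
    have hopen : IsOpen {y : EuclideanSpace ℝ (Fin (n + 1)) | inner ℝ e y < τ} :=
      isOpen_lt (by fun_prop) continuous_const
    filter_upwards [isOpen_offAxis.mem_nhds hx, hopen.mem_nhds hxτ] with y hy hyτ hy1
    exact sub_nonneg.2 (hgood y hy hy1 (le_of_lt hyτ))
  have hlap := hloc.laplacian_nonneg (hV.contDiffAt_diff he heN h0 h1 hx hx'.le)
  -- At a contact point the powers cancel and the strict loss in the weight gives `-Δ W > 0`,
  -- against `Δ W ≥ 0` at a minimum. Since `c > 0`, no strong maximum principle is needed.
  have hR2 : ‖lorentzReflection e τ x‖ ^ (-2 : ℝ) < 1 :=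
    Real.rpow_lt_one_of_one_lt_of_neg hnorm (by norm_num)
  rw [heq] at hlapW hVR
  have h3 : 0 < c * (V x - ‖lorentzReflection e τ x‖ ^ (-2 : ℝ) * V x) :=
    mul_pos hc (by nlinarith)
  linarith

/-- The moving plane procedure can be started near `τ = 1`. -/
theorem IsConformalSolution.exists_start (hV : IsConformalSolution n k p c V)
    (hk0 : 0 < k)
    (he : ‖e‖ = 1) (heN : inner ℝ (northPole n : EuclideanSpace ℝ (Fin (n + 1))) e = 0)
    {τ₁ : ℝ} (hτ₁ : 0 < τ₁) (hτ₁1 : τ₁ < 1) {δ : ℝ} (hδ : 0 < δ) :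
    ∃ τ, τ₁ ≤ τ ∧ τ < 1 ∧ ∀ x ∈ offAxis n, ‖x‖ = 1 → inner ℝ e x ≤ τ - δ →
        δ ≤ 1 - (inner ℝ (northPole n : EuclideanSpace ℝ (Fin (n + 1))) x) ^ 2 →
        V (lorentzReflection e τ x) ≤ V x := by
  obtain ⟨A, hA0, hA⟩ := hV.exists_reflected_le he heN hτ₁
  obtain ⟨m, hm, hmV⟩ : ∃ m > 0, ∀ x : EuclideanSpace ℝ (Fin (n + 1)), ‖x‖ = 1 →
      δ ≤ 1 - (inner ℝ (northPole n : EuclideanSpace ℝ (Fin (n + 1))) x) ^ 2 → m ≤ V x := by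
    set C : Set (EuclideanSpace ℝ (Fin (n + 1))) := Metric.sphere 0 1 ∩
      {x | δ ≤ 1 - (inner ℝ (northPole n : EuclideanSpace ℝ (Fin (n + 1))) x) ^ 2} with hCdef
    have hC : IsCompact C := (isCompact_sphere _ _).inter_right
      (isClosed_le continuous_const (by fun_prop))
    have hsub : C ⊆ offAxis n := fun x hx => by
      have h1 : ‖x‖ = 1 := by simpa using hx.1
      have h2 := hx.2
      simp only [offAxis, Set.mem_ofPred_eq, h1] at h2 ⊢
      linarith
    rcases C.eq_empty_or_nonempty with hempty | hne
    · refine ⟨1, one_pos, fun x hx hxδ => ?_⟩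
      have : x ∈ C := ⟨by simpa using hx, hxδ⟩
      rw [hempty] at this
      exact this.elim
    · obtain ⟨x₀, hx₀, hmin⟩ := hC.exists_isMinOn hne (f := V) fun x hx =>
        (hV.contDiffAt x (hsub hx)).continuousAt.continuousWithinAt
      exact ⟨_, hV.pos _ (hsub hx₀), fun x hx hxδ => hmin ⟨by simpa using hx, hxδ⟩⟩
  have hlim : Tendsto (fun r : ℝ => A * r ^ (-k)) atTop (𝓝 0) := by
    simpa using (tendsto_rpow_neg_atTop hk0).const_mul A
  obtain ⟨R, hR⟩ := eventually_atTop.1 (hlim.eventually (gt_mem_nhds hm))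
  set R' := max R 1
  have hR'0 : 0 < R' := by positivity
  -- With `τ = 1 - η` one has `2 / (1 - τ ^ 2) ≥ 1 / η`, so `‖R x‖ ≥ τ₁ * δ / η ≥ R'` at distance
  -- `δ` from the cap boundary.
  set η := min (1 - τ₁) (τ₁ * δ / R')
  have hη : 0 < η := lt_min (by linarith) (by positivity)
  have hη1 : η ≤ 1 - τ₁ := min_le_left _ _
  have hη2 : η * R' ≤ τ₁ * δ := (le_div_iff₀ hR'0).1 (min_le_right _ _)
  refine ⟨1 - η, by linarith, by linarith, fun x hx hx1 hxτ hxδ => ?_⟩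
  have hx2 : inner ℝ e x ≤ 1 - η := by linarith
  refine (hA (1 - η) (by linarith) (by linarith) x hx1 hx2).trans ((hR _ ?_).le.trans
    (hmV x hx1 hxδ))
  refine (le_max_left R 1).trans ?_
  rw [norm_lorentzReflection he (by linarith) (by linarith) (by rwa [hx1, mul_one]), hx1, mul_one]
  have h1 : 1 - (1 - η) ^ 2 = η * (2 - η) := by ring
  have h2 : 1 / η ≤ 2 / (1 - (1 - η) ^ 2) := by
    rw [h1, div_le_div_iff₀ hη (by nlinarith)]
    nlinarith
  have h3 : R' ≤ τ₁ * (1 / η * δ) := by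
    have : τ₁ * (1 / η * δ) = τ₁ * δ / η := by ring
    rw [this, le_div_iff₀ hη]
    linarith
  have h4 : 1 / η * δ ≤ 2 / (1 - (1 - η) ^ 2) * (1 - η - inner ℝ e x) :=
    mul_le_mul h2 (by linarith) hδ.le (le_trans (by positivity) h2)
  have h5 : τ₁ * (1 / η * δ) ≤ (1 - η) * (2 / (1 - (1 - η) ^ 2) * (1 - η - inner ℝ e x)) :=
    mul_le_mul (by linarith) h4 (by positivity) (by linarith)
  linarith

/-- The moving plane procedure can be continued. -/
theorem IsConformalSolution.eventually_continue (hV : IsConformalSolution n k p c V)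
    (hk : (n : ℝ) = 2 * k + 2) (hc : 0 < c)
    (he : ‖e‖ = 1) (heN : inner ℝ (northPole n : EuclideanSpace ℝ (Fin (n + 1))) e = 0)
    {τ : ℝ} (h0 : 0 < τ) (h1 : τ < 1)
    (hgood : ∀ x ∈ offAxis n, ‖x‖ = 1 → inner ℝ e x ≤ τ → V (lorentzReflection e τ x) ≤ V x)
    {δ : ℝ} (hδ : 0 < δ) :
    ∀ᶠ τ' in 𝓝 τ, ∀ x ∈ offAxis n, ‖x‖ = 1 → inner ℝ e x ≤ τ - δ →
        δ ≤ 1 - (inner ℝ (northPole n : EuclideanSpace ℝ (Fin (n + 1))) x) ^ 2 →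
        V (lorentzReflection e τ' x) ≤ V x := by
  set C : Set (EuclideanSpace ℝ (Fin (n + 1))) := Metric.sphere 0 1 ∩
    ({x | inner ℝ e x ≤ τ - δ} ∩
    {x | δ ≤ 1 - (inner ℝ (northPole n : EuclideanSpace ℝ (Fin (n + 1))) x) ^ 2}) with hCdef
  have hC : IsCompact C := (isCompact_sphere _ _).inter_right
    ((isClosed_le (by fun_prop) continuous_const).inter
      (isClosed_le continuous_const (by fun_prop)))
  have hsub : C ⊆ offAxis n := fun x hx => by
    have h1 : ‖x‖ = 1 := by simpa using hx.1
    have h2 := hx.2.2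
    simp only [offAxis, Set.mem_ofPred_eq, h1] at h2 ⊢
    linarith
  -- A strict inequality between functions jointly continuous in `(τ', x)` is stable, uniformly over
  -- the compact set `C`.
  have key : ∀ᶠ τ' in 𝓝 τ, ∀ x ∈ C, V (lorentzReflection e τ' x) < V x := by
    refine hC.eventually_forall_of_forall_eventually fun x hx => ?_
    have hx1 : ‖x‖ = 1 := by simpa using hx.1
    have hxτ : inner ℝ e x ≤ τ - δ := hx.2.1
    have hxA := hsub hx
    have hR := lorentzReflection_mem_offAxis he heN h0 h1 (ne_zero_of_mem_offAxis hxA)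
      (by rw [hx1]; linarith)
    have hc1 : ContinuousAt
        (fun z : ℝ × EuclideanSpace ℝ (Fin (n + 1)) => V (lorentzReflection e z.1 z.2)) (τ, x) :=
      ContinuousAt.comp (g := V) (hV.contDiffAt _ hR).continuousAt
        (continuousAt_lorentzReflection_uncurry e (by nlinarith) x)
    have hc2 : ContinuousAt (fun z : ℝ × EuclideanSpace ℝ (Fin (n + 1)) => V z.2) (τ, x) :=
      ContinuousAt.comp (g := V) (hV.contDiffAt x hxA).continuousAt continuousAt_snd
    exact hc1.eventually_lt hc2
      (hV.reflected_lt hk hc he heN h0 h1 hgood hxA hx1 (by linarith))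
  filter_upwards [key] with τ' hτ' x hx hx1 hxτ hxδ
  exact (hτ' x ⟨by simpa using hx1, hxτ, hxδ⟩).le

/-- The outcome of the moving plane procedure. -/
theorem IsConformalSolution.reflected_le (hV : IsConformalSolution n k p c V)
    (hk : (n : ℝ) = 2 * k + 2) (hk0 : 0 < k) (hp : 1 ≤ p) (hc : 0 < c)
    (he : ‖e‖ = 1) (heN : inner ℝ (northPole n : EuclideanSpace ℝ (Fin (n + 1))) e = 0)
    {τ₁ : ℝ} (hτ₁ : 0 < τ₁) (hτ₁1 : τ₁ < 1) :
    ∀ x ∈ offAxis n, ‖x‖ = 1 → inner ℝ e x ≤ τ₁ → V (lorentzReflection e τ₁ x) ≤ V x := by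
  obtain ⟨δ, hδ, hcomp⟩ := hV.reflected_le_of_compact hk hk0 hp hc.le he heN hτ₁
  obtain ⟨τ₂, hτ₁₂, hτ₂1, hstart⟩ := hV.exists_start hk0 he heN hτ₁ hτ₁1 hδ
  set s : Set ℝ := {τ | ∀ x ∈ offAxis n, ‖x‖ = 1 → inner ℝ e x ≤ τ →
    V (lorentzReflection e τ x) ≤ V x} with hs
  have hclosed : IsClosed (s ∩ Icc τ₁ τ₂) := by
    refine isClosed_of_closure_subset fun τ hτ => ?_
    have hτI : τ ∈ Icc τ₁ τ₂ := closure_minimal inter_subset_right isClosed_Icc hτ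
    refine ⟨fun x hx hx1 hxτ => ?_, hτI⟩
    have h0 : 0 < τ := hτ₁.trans_le hτI.1
    rcases hxτ.eq_or_lt with heq | hlt
    · rw [lorentzReflection_eq_self (by rw [heq, hx1, mul_one])]
    · by_contra! hneg
      have hR := lorentzReflection_mem_offAxis he heN h0 (hτI.2.trans_lt hτ₂1)
        (ne_zero_of_mem_offAxis hx) (by rwa [hx1, mul_one])
      have hc0 : ContinuousAt (fun t : ℝ => lorentzReflection e t x) τ :=
        ContinuousAt.comp (g := fun z : ℝ × EuclideanSpace ℝ (Fin (n + 1)) =>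
          lorentzReflection e z.1 z.2) (f := fun t => (t, x))
          (continuousAt_lorentzReflection_uncurry e (by nlinarith [hτI.2]) x) (by fun_prop)
      have hc1 : ContinuousAt (fun t : ℝ => V (lorentzReflection e t x)) τ :=
        ContinuousAt.comp (g := V) (hV.contDiffAt _ hR).continuousAt hc0
      have hev := (continuousAt_const.eventually_lt hc1 hneg).and (lt_mem_nhds hlt)
      obtain ⟨t, ⟨ht1, ht2⟩, ht3⟩ := (hev.and_frequently (mem_closure_iff_frequently.1 hτ)).exists
      exact absurd (ht3.1 x hx hx1 ht2.le) (not_le.2 ht1)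
  have hτ₂s : τ₂ ∈ s := hcomp τ₂ hτ₁₂ hτ₂1 hstart
  -- Continuity argument downwards from `τ₂`. The same `δ` serves for every `τ ≥ τ₁`, so the compact
  -- comparison at `τ` passes to slightly smaller parameters.
  refine hclosed.Icc_subset_of_forall_exists_lt hτ₂s ?_ ⟨le_rfl, hτ₁₂⟩
  rintro τ ⟨hτs, hτI⟩ y hy
  have hy' : y < τ := hy
  have hτ1 : τ < 1 := hτI.2.trans_lt hτ₂1
  have hev := hV.eventually_continue hk hc he heN (hτ₁.trans hτI.1) hτ1 hτs hδ
  obtain ⟨l, hl, hl'⟩ := exists_Ioc_subset_of_mem_nhds hev ⟨y, hy'⟩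
  set t := (max (max l y) τ₁ + τ) / 2
  have hmax : max (max l y) τ₁ < τ := max_lt (max_lt hl hy') hτI.1
  have hm1 : l ≤ max (max l y) τ₁ := (le_max_left l y).trans (le_max_left _ _)
  have hm2 : y ≤ max (max l y) τ₁ := (le_max_right l y).trans (le_max_left _ _)
  have hm3 : τ₁ ≤ max (max l y) τ₁ := le_max_right _ _
  have ht1 : max (max l y) τ₁ < t := by simp only [t]; linarith
  have ht2 : t < τ := by simp only [t]; linarith
  refine ⟨t, hcomp t (by linarith) (by linarith) fun x hx hx1 hxt hxδ => ?_, by linarith, ht2⟩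
  exact hl' ⟨by linarith, ht2.le⟩ x hx hx1 (by linarith) hxδ

theorem lorentzReflection_zero {E : Type*} [NormedAddCommGroup E] [InnerProductSpace ℝ E] (e x : E) :
    lorentzReflection e 0 x = x - (2 * inner ℝ e x) • e := by
  simp [lorentzReflection, sub_eq_add_neg]

/-- Limit `τ ↓ 0` of the comparison. The cap argument no longer places the image off the axis at `τ
= 0`, so this is a hypothesis. -/
theorem IsConformalSolution.reflection_le (hV : IsConformalSolution n k p c V)
    (hk : (n : ℝ) = 2 * k + 2) (hk0 : 0 < k) (hp : 1 ≤ p) (hc : 0 < c)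
    (he : ‖e‖ = 1) (heN : inner ℝ (northPole n : EuclideanSpace ℝ (Fin (n + 1))) e = 0)
    {x : EuclideanSpace ℝ (Fin (n + 1))} (hx : x ∈ offAxis n) (hx1 : ‖x‖ = 1)
    (hxe : inner ℝ e x ≤ 0) (hRx : lorentzReflection e 0 x ∈ offAxis n) :
    V (lorentzReflection e 0 x) ≤ V x := by
  have hc0 : ContinuousAt (fun t : ℝ => lorentzReflection e t x) 0 :=
    ContinuousAt.comp (g := fun z : ℝ × EuclideanSpace ℝ (Fin (n + 1)) =>
      lorentzReflection e z.1 z.2) (f := fun t => (t, x))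
      (continuousAt_lorentzReflection_uncurry e (by norm_num) x) (by fun_prop)
  have hc1 : ContinuousAt (fun t : ℝ => V (lorentzReflection e t x)) 0 :=
    ContinuousAt.comp (g := V) (hV.contDiffAt _ hRx).continuousAt hc0
  refine le_of_tendsto (hc1.tendsto.mono_left (nhdsWithin_le_nhds (s := Ioi 0))) ?_
  filter_upwards [Ioo_mem_nhdsGT (zero_lt_one' ℝ)] with t ht
  exact hV.reflected_le hk hk0 hp hc he heN ht.1 ht.2 x hx hx1 (hxe.trans ht.1.le)

/-- The mirror orthogonal to `y - x` contains the axis and exchanges `x` and `y`. Equality follows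
by swapping their roles. -/
theorem IsConformalSolution.eq_of_reflection (hV : IsConformalSolution n k p c V)
    (hk : (n : ℝ) = 2 * k + 2) (hk0 : 0 < k) (hp : 1 ≤ p) (hc : 0 < c)
    {x y : EuclideanSpace ℝ (Fin (n + 1))} (hx : x ∈ offAxis n) (hx1 : ‖x‖ = 1)
    (hy : y ∈ offAxis n) (hy1 : ‖y‖ = 1)
    (hxy : inner ℝ (northPole n : EuclideanSpace ℝ (Fin (n + 1))) x =
      inner ℝ (northPole n : EuclideanSpace ℝ (Fin (n + 1))) y) : V y ≤ V x := by
  by_cases hne : y - x = 0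
  · rw [sub_eq_zero.1 hne]
  have hpos : 0 < ‖y - x‖ := norm_pos_iff.2 hne
  have hsq : ‖y - x‖ ^ 2 = 2 - 2 * inner ℝ y x := by
    rw [norm_sub_sq_real, hx1, hy1]; ring
  set e := ‖y - x‖⁻¹ • (y - x) with he
  have he1 : ‖e‖ = 1 := by rw [he, norm_smul, norm_inv, norm_norm, inv_mul_cancel₀ hpos.ne']
  have heN : inner ℝ (northPole n : EuclideanSpace ℝ (Fin (n + 1))) e = 0 := by
    rw [he, inner_smul_right, inner_sub_right, hxy, sub_self, mul_zero]
  have hex : inner ℝ e x = -(‖y - x‖ / 2) := by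
    rw [he, inner_smul_left, inner_sub_left, real_inner_self_eq_norm_sq, hx1]
    have : inner ℝ y x - 1 ^ 2 = -(‖y - x‖ ^ 2 / 2) := by linarith
    rw [this]
    simp
    field_simp
  have hR : lorentzReflection e 0 x = y := by
    rw [lorentzReflection_zero, hex, he, smul_smul]
    have : 2 * -(‖y - x‖ / 2) * ‖y - x‖⁻¹ = -1 := by field_simp
    rw [this]
    simp
  have := hV.reflection_le hk hk0 hp hc he1 heN hx hx1 (by rw [hex]; linarith) (by rwa [hR])
  rwa [hR] at this

theorem IsPositiveSolution.isRotationallySymmetric (hn : 3 ≤ n) {β : ℝ}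
    (hβ : β < (n : ℝ) * ((n : ℝ) - 2) / 4) {v : puncturedSphere n → ℝ}
    (hv : IsPositiveSolution n β v) : IsRotationallySymmetric v := by
  intro A hA θ θ' hθ
  have hn' : (3 : ℝ) ≤ n := by exact_mod_cast hn
  have hV := hv.isConformalSolution hn
  have h1 : ∀ θ : puncturedSphere n, ‖((θ : Sph n) : EuclideanSpace ℝ (Fin (n + 1)))‖ = 1 :=
    fun θ => norm_eq_of_mem_sphere _
  have hV1 : ∀ θ : puncturedSphere n,
      ‖((θ : Sph n) : EuclideanSpace ℝ (Fin (n + 1)))‖ ^ (-(((n : ℝ) - 2) / 2)) *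
        radialExtension v ((θ : Sph n) : EuclideanSpace ℝ (Fin (n + 1))) = v θ := fun θ => by
    rw [h1, Real.one_rpow, one_mul, radialExtension_coe]
  have hN : inner ℝ (northPole n : EuclideanSpace ℝ (Fin (n + 1)))
      ((θ : Sph n) : EuclideanSpace ℝ (Fin (n + 1))) =
      inner ℝ (northPole n : EuclideanSpace ℝ (Fin (n + 1)))
        ((θ' : Sph n) : EuclideanSpace ℝ (Fin (n + 1))) := by
    rw [hθ]
    conv_rhs => rw [← hA]
    exact (A.inner_map_map _ _).symm
  have hk : (n : ℝ) = 2 * (((n : ℝ) - 2) / 2) + 2 := by ring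
  have hp : 1 ≤ ((n : ℝ) + 2) / ((n : ℝ) - 2) := by
    rw [le_div_iff₀ (by linarith)]; linarith
  have hA1 := (mem_puncturedSphere_iff _).1 θ.2
  have hA2 := (mem_puncturedSphere_iff _).1 θ'.2
  have e1 := hV.eq_of_reflection hk (by linarith) hp (by linarith) hA1 (h1 θ) hA2 (h1 θ') hN
  have e2 := hV.eq_of_reflection hk (by linarith) hp (by linarith) hA2 (h1 θ') hA1 (h1 θ) hN.symm
  simp only [hV1] at e1 e2
  exact le_antisymm e1 e2

end MovingPlanes

/-! ### Global integral curves. -/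

section GlobalODE

open scoped NNReal

/-- A bounded vector field that is uniformly Lipschitz has global integral curves. -/
theorem exists_forall_hasDerivAt_of_lipschitz_of_bounded {E : Type*} [NormedAddCommGroup E]
    [NormedSpace ℝ E] [CompleteSpace E] {f : ℝ → E → E} {K L : ℝ≥0}
    (hlip : ∀ t, LipschitzWith K (f t)) (hcont : ∀ x, Continuous fun t => f t x)
    (hb : ∀ t x, ‖f t x‖ ≤ L) (x₀ : E) :
    ∃ α : ℝ → E, α 0 = x₀ ∧ ∀ t, HasDerivAt α (f t (α t)) t := by
  have hloc : ∀ N : ℕ, ∃ α : ℝ → E, α 0 = x₀ ∧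
      ∀ t ∈ Ioo (-((N : ℝ) + 1)) ((N : ℝ) + 1), HasDerivAt α (f t (α t)) t := by
    intro N
    have h0 : (0 : ℝ) ∈ Icc (-((N : ℝ) + 1)) ((N : ℝ) + 1) := by constructor <;> linarith
    have hPL : IsPicardLindelof f (tmin := -((N : ℝ) + 1)) (tmax := (N : ℝ) + 1) ⟨0, h0⟩ x₀
        (L * (N + 1)) 0 L K :=
      { lipschitzOnWith := fun t _ => (hlip t).lipschitzOnWith
        continuousOn := fun x _ => (hcont x).continuousOn
        norm_le := fun t _ x _ => hb t x
        mul_max_le := by simp }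
    obtain ⟨α, hα0, hα⟩ := hPL.exists_eq_forall_mem_Icc_hasDerivWithinAt₀
    exact ⟨α, hα0, fun t ht => (hα t (Ioo_subset_Icc_self ht)).hasDerivAt
      (Icc_mem_nhds ht.1 ht.2)⟩
  choose A hA0 hA using hloc
  have hAeq : ∀ M N : ℕ, M ≤ N → EqOn (A M) (A N) (Ioo (-((M : ℝ) + 1)) ((M : ℝ) + 1)) := by
    intro M N hMN
    have hMN' : (M : ℝ) ≤ N := by exact_mod_cast hMN
    refine ODE_solution_unique_of_mem_Ioo (v := f) (s := fun _ => univ) (K := K) (t₀ := 0)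
      (fun t _ => (hlip t).lipschitzOnWith) (by constructor <;> linarith)
      (fun t ht => ⟨hA M t ht, mem_univ _⟩)
      (fun t ht => ⟨hA N t ⟨by linarith [ht.1], by linarith [ht.2]⟩, mem_univ _⟩)
      ((hA0 M).trans (hA0 N).symm)
  have hmem : ∀ s : ℝ, s ∈ Ioo (-((⌈|s|⌉₊ : ℝ) + 1)) ((⌈|s|⌉₊ : ℝ) + 1) := fun s => by
    have h := Nat.le_ceil |s|
    rw [mem_Ioo, ← abs_lt]
    linarith
  refine ⟨fun t => A ⌈|t|⌉₊ t, by simp [hA0], fun t => ?_⟩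
  set N := ⌈|t|⌉₊
  -- The index jumps with `s`, but near `t` it is at most `N + 1`, so uniqueness identifies the
  -- glued curve with one fixed solution.
  have hev : (fun s => A ⌈|s|⌉₊ s) =ᶠ[𝓝 t] A (N + 1) := by
    filter_upwards [isOpen_Ioo.mem_nhds (hmem t)] with s hs
    refine hAeq _ _ (Nat.ceil_le.2 ?_) (hmem s)
    have := abs_lt.2 hs
    push_cast
    exact this.le
  have ht : t ∈ Ioo (-(((N + 1 : ℕ) : ℝ) + 1)) (((N + 1 : ℕ) : ℝ) + 1) := by
    have := hmem t
    push_cast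
    exact ⟨by linarith [this.1], by linarith [this.2]⟩
  have h1 := (hA (N + 1) t ht).congr_of_eventuallyEq hev
  rwa [← hev.eq_of_nhds] at h1

end GlobalODE

/-! ### Truncation and Lipschitz bounds. -/

section Clamp

/-- Truncation of a real number to `[m, M]`. -/
noncomputable def clamp (m M x : ℝ) : ℝ := max m (min x M)

theorem clamp_mem {m M : ℝ} (h : m ≤ M) (x : ℝ) : clamp m M x ∈ Icc m M :=
  ⟨le_max_left _ _, max_le h (min_le_right _ _)⟩

theorem clamp_of_mem {m M x : ℝ} (h : x ∈ Icc m M) : clamp m M x = x := by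
  rw [clamp, min_eq_left h.2, max_eq_right h.1]

theorem abs_clamp_sub_clamp_le (m M x y : ℝ) : |clamp m M x - clamp m M y| ≤ |x - y| := by
  refine (abs_max_sub_max_le_max m (min x M) m (min y M)).trans ?_
  rw [sub_self, abs_zero, max_eq_right (abs_nonneg _)]
  refine (abs_min_sub_min_le_max x M y M).trans ?_
  rw [sub_self, abs_zero, max_eq_left (abs_nonneg _)]

theorem clamp_neg {B : ℝ} (hB : 0 ≤ B) (y : ℝ) : clamp (-B) B (-y) = -clamp (-B) B y := by
  simp only [clamp]
  grind

theorem abs_rpow_sub_rpow_le {a b M p : ℝ} (ha : 0 < a) (hb : 0 < b) (haM : a ≤ M) (hbM : b ≤ M)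
    (hp : 1 ≤ p) : |a ^ p - b ^ p| ≤ p * M ^ (p - 1) * |a - b| := by
  have key : ∀ a b : ℝ, 0 < a → 0 < b → a ≤ M → b ≤ M → b ≤ a →
      |a ^ p - b ^ p| ≤ p * M ^ (p - 1) * |a - b| := by
    intro a b ha hb haM hbM hab
    have h1 := rpow_sub_rpow_ge hb ha hp
    have h2 : b ^ p ≤ a ^ p := Real.rpow_le_rpow hb.le hab (by linarith)
    have h3 : a ^ (p - 1) ≤ M ^ (p - 1) := Real.rpow_le_rpow ha.le haM (by linarith)
    rw [abs_of_nonneg (sub_nonneg.2 h2), abs_of_nonneg (sub_nonneg.2 hab)]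
    have h4 : p * a ^ (p - 1) * (a - b) ≤ p * M ^ (p - 1) * (a - b) :=
      mul_le_mul_of_nonneg_right (mul_le_mul_of_nonneg_left h3 (by linarith)) (by linarith)
    linarith
  rcases le_total b a with h | h
  · exact key a b ha hb haM hbM h
  · rw [abs_sub_comm, abs_sub_comm a b]
    exact key b a hb ha hbM haM h

end Clamp

/-! ### Energy and global positive solutions of the Emden–Fowler equation. -/

section EmdenFowler

theorem hasDerivAt_inv_cosh_sq (t : ℝ) :
    HasDerivAt (fun t => (Real.cosh t ^ 2)⁻¹) (-(2 * Real.sinh t / Real.cosh t ^ 3)) t := by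
  have h := Real.cosh_pos t
  refine (((Real.hasDerivAt_cosh t).pow 2).fun_inv (pow_ne_zero 2 h.ne')).congr_deriv ?_
  simp only [Pi.pow_apply]
  field_simp
  push_cast
  ring

theorem inv_cosh_sq_le_one (t : ℝ) : (Real.cosh t ^ 2)⁻¹ ≤ 1 :=
  inv_le_one_of_one_le₀ (one_le_pow₀ (Real.one_le_cosh t))

variable {k p c : ℝ}

/-- The sublevel sets of the energy at negative levels are compact in `{x > 0}`. -/
theorem exists_energy_bounds (hk : 0 < k) (hp : 1 < p) {F₀ : ℝ} (hF₀ : F₀ < 0) :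
    ∃ m > 0, ∃ M > 0, ∀ x y q : ℝ, 0 < x → q ≤ k ^ 2 →
      y ^ 2 / 2 - q * x ^ 2 / 2 + x ^ (p + 1) / (p + 1) ≤ F₀ → m ≤ x ∧ x ≤ M ∧ |y| ≤ M := by
  -- Negative energy gives `x ^ (p + 1) / (p + 1) ≤ k ^ 2 * x ^ 2`, hence `x ≤ M`; likewise `k ^ 2 *
  -- x ^ 2 ≥ -2 * F₀` and `|y| ≤ k * x` supply the other bounds.
  set M := (k ^ 2 * (p + 1)) ^ (p - 1)⁻¹
  have hM : 0 < M := by positivity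
  refine ⟨√(-2 * F₀) / k, by have : 0 < -2 * F₀ := by linarith
                             positivity, max M (k * M), by positivity, ?_⟩
  intro x y q hx hq hF
  have hxp : 0 < x ^ (p + 1) / (p + 1) := by positivity
  have hqx : q * x ^ 2 ≤ k ^ 2 * x ^ 2 := mul_le_mul_of_nonneg_right hq (sq_nonneg x)
  have hy := sq_nonneg y
  have hxM : x ≤ M := by
    have h1 : x ^ (p + 1) / (p + 1) ≤ k ^ 2 * x ^ 2 := by nlinarith
    have h2 : x ^ (p + 1) = x ^ (p - 1) * x ^ 2 := by
      rw [← Real.rpow_natCast x 2, ← Real.rpow_add hx]; congr 1; push_cast; ring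
    rw [h2, div_le_iff₀ (by linarith)] at h1
    have h3 : x ^ (p - 1) ≤ k ^ 2 * (p + 1) :=
      le_of_mul_le_mul_right (by linarith) (show 0 < x ^ 2 by positivity)
    have h4 := Real.rpow_le_rpow (Real.rpow_nonneg hx.le _) h3
      (show 0 ≤ (p - 1)⁻¹ from inv_nonneg.2 (by linarith))
    rwa [Real.rpow_rpow_inv hx.le (by linarith)] at h4
  refine ⟨?_, hxM.trans (le_max_left _ _), ?_⟩
  · rw [div_le_iff₀ hk]
    refine Real.sqrt_le_iff.2 ⟨by positivity, ?_⟩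
    nlinarith
  · refine (abs_le_of_sq_le_sq ?_ (by positivity)).trans (le_max_right M (k * M))
    have : x ^ 2 ≤ M ^ 2 := pow_le_pow_left₀ hx.le hxM 2
    nlinarith

/-- Solutions of the truncated equation with small data never leave the region where the
truncation is inactive. -/
theorem truncated_solution_mem {c : ℝ} (hc : 0 ≤ c) (hp : 1 < p) {F₀ m M : ℝ} (hm : 0 < m)
    (hM : 0 < M)
    (hbound : ∀ x y q : ℝ, 0 < x → q ≤ k ^ 2 →
      y ^ 2 / 2 - q * x ^ 2 / 2 + x ^ (p + 1) / (p + 1) ≤ F₀ → m ≤ x ∧ x ≤ M ∧ |y| ≤ M)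
    {x y : ℝ → ℝ} (hx : ∀ t, HasDerivAt x (clamp (-(2 * M)) (2 * M) (y t)) t)
    (hy : ∀ t, HasDerivAt y ((k ^ 2 - c * (Real.cosh t ^ 2)⁻¹) * clamp (m / 2) (2 * M) (x t) -
      clamp (m / 2) (2 * M) (x t) ^ p) t)
    (hx0 : 0 < x 0)
    (h0 : y 0 ^ 2 / 2 - (k ^ 2 - c * (Real.cosh 0 ^ 2)⁻¹) * x 0 ^ 2 / 2 +
      x 0 ^ (p + 1) / (p + 1) ≤ F₀) {t : ℝ} (ht : 0 ≤ t) :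
    m / 2 < x t ∧ x t < 2 * M ∧ |y t| < 2 * M ∧ m ≤ x t := by
  have hxc : Continuous x := continuous_iff_continuousAt.2 fun t => (hx t).continuousAt
  have hyc : Continuous y := continuous_iff_continuousAt.2 fun t => (hy t).continuousAt
  set q : ℝ → ℝ := fun t => k ^ 2 - c * (Real.cosh t ^ 2)⁻¹ with hq
  have hqd : ∀ t, HasDerivAt q (c * (2 * Real.sinh t / Real.cosh t ^ 3)) t := fun t => by
    refine (((hasDerivAt_inv_cosh_sq t).const_mul c).const_sub (k ^ 2)).congr_deriv ?_
    ring
  have hqc : Continuous q := continuous_iff_continuousAt.2 fun t => (hqd t).continuousAt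
  have hqk : ∀ t, q t ≤ k ^ 2 := fun t => by
    have : 0 ≤ c * (Real.cosh t ^ 2)⁻¹ := by positivity
    simp only [hq]; linarith
  set F : ℝ → ℝ := fun t => y t ^ 2 / 2 - q t * x t ^ 2 / 2 + x t ^ (p + 1) / (p + 1) with hF
  have hFc : Continuous F := by
    have : Continuous fun t => x t ^ (p + 1) :=
      hxc.rpow_const fun t => Or.inr (by linarith)
    fun_prop
  -- While the truncation is inactive, the energy varies only through the coefficient: `F' = -q' * x
  -- ^ 2 / 2`, which is nonpositive for `t ≥ 0`.
  have hFd : ∀ t, m / 2 < x t → x t < 2 * M → |y t| < 2 * M →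
      HasDerivAt F (-(c * (2 * Real.sinh t / Real.cosh t ^ 3)) * x t ^ 2 / 2) t := by
    intro t h1 h2 h3
    have hX : clamp (m / 2) (2 * M) (x t) = x t := clamp_of_mem ⟨h1.le, h2.le⟩
    have hY : clamp (-(2 * M)) (2 * M) (y t) = y t :=
      clamp_of_mem ⟨(abs_lt.1 h3).1.le, (abs_lt.1 h3).2.le⟩
    have hx' := hx t
    have hy' := hy t
    rw [hY] at hx'
    rw [hX] at hy'
    have e1 := (hy'.pow 2).div_const 2
    have e2 := ((hqd t).mul (hx'.pow 2)).div_const 2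
    have e3 := (hx'.rpow_const (p := p + 1) (Or.inr (by linarith))).div_const (p + 1)
    refine ((e1.sub e2).add e3).congr_deriv ?_
    have : p + 1 ≠ 0 := by linarith
    simp only [add_sub_cancel_right, hq, Pi.pow_apply]
    field_simp
    push_cast
    ring
  set U : Set ℝ := {t | m / 2 < x t} ∩ ({t | x t < 2 * M} ∩ {t | |y t| < 2 * M}) with hU
  have hUo : IsOpen U := (isOpen_lt continuous_const hxc).inter
    ((isOpen_lt hxc continuous_const).inter (isOpen_lt hyc.abs continuous_const))
  have hgood : ∀ t, 0 < x t → F t ≤ F₀ → t ∈ U ∧ m ≤ x t := fun t h1 h2 => by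
    obtain ⟨h3, h4, h5⟩ := hbound (x t) (y t) (q t) h1 (hqk t) h2
    exact ⟨⟨show m / 2 < x t by linarith, show x t < 2 * M by linarith,
      show |y t| < 2 * M by linarith⟩, h3⟩
  -- No first exit from `U`: up to time `T` the energy stays at most `F₀`, which gives the bounds
  -- `m` and `M`, strictly inside the truncation levels `m / 2` and `2 * M`.
  have hstep : ∀ T, 0 ≤ T → Ico 0 T ⊆ U → T ∈ U ∧ m ≤ x T := by
    intro T hT hsub
    rcases hT.eq_or_lt with rfl | hT0
    · exact hgood 0 hx0 h0
    refine hgood T ?_ ?_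
    · have hcl : closure (Ico 0 T) ⊆ {t | m / 2 ≤ x t} :=
        closure_minimal (fun t ht => show m / 2 ≤ x t from le_of_lt (hsub ht).1) (isClosed_le continuous_const hxc)
      rw [closure_Ico hT0.ne] at hcl
      have h1 : m / 2 ≤ x T := hcl ⟨hT, le_rfl⟩
      linarith
    · have hanti : AntitoneOn F (Icc 0 T) := by
        refine antitoneOn_of_hasDerivWithinAt_nonpos (convex_Icc 0 T) hFc.continuousOn
          (f' := fun t => -(c * (2 * Real.sinh t / Real.cosh t ^ 3)) * x t ^ 2 / 2)
          (fun t ht => ?_) fun t ht => ?_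
        · rw [interior_Icc] at ht
          have h1 := hsub ⟨ht.1.le, ht.2⟩
          exact (hFd t h1.1 h1.2.1 h1.2.2).hasDerivWithinAt
        · rw [interior_Icc] at ht
          have h2 := Real.sinh_pos_iff.2 ht.1
          have h3 := Real.cosh_pos t
          have h4 : 0 ≤ c * (2 * Real.sinh t / Real.cosh t ^ 3) * x t ^ 2 / 2 := by positivity
          linarith
      exact (hanti ⟨le_rfl, hT⟩ ⟨hT, le_rfl⟩ hT).trans h0
  have hall : Ici 0 ⊆ U := by
    by_contra hne
    set S := Ici (0 : ℝ) ∩ Uᶜ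
    have hSne : S.Nonempty := by
      obtain ⟨t, ht, htU⟩ := not_subset.1 hne
      exact ⟨t, ht, htU⟩
    have hSc : IsClosed S := isClosed_Ici.inter hUo.isClosed_compl
    have hSb : BddBelow S := ⟨0, fun t ht => ht.1⟩
    have hTS := hSc.csInf_mem hSne hSb
    refine hTS.2 (hstep _ hTS.1 fun t ht => ?_).1
    by_contra htU
    exact absurd (csInf_le hSb ⟨ht.1, htU⟩) (not_le.2 ht.2)
  have h1 := hall ht
  exact ⟨h1.1, h1.2.1, h1.2.2, (hstep t ht (Ico_subset_Ici_self.trans hall)).2⟩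

open scoped NNReal in
/-- Positive global solutions of `w'' = (k² - c / cosh²) w - w ^ p`. -/
theorem exists_emdenFowler_solution (hk : 0 < k) (hc : 0 ≤ c) (hck : c < k ^ 2) (hp : 1 < p)
    {a : ℝ} (ha : 0 < a) (hap : a ^ (p - 1) < (k ^ 2 - c) * (p + 1) / 2) :
    ∃ w w' : ℝ → ℝ, w 0 = a ∧ (∀ t, HasDerivAt w (w' t) t) ∧
      (∀ t, HasDerivAt w' ((k ^ 2 - c * (Real.cosh t ^ 2)⁻¹) * w t - w t ^ p) t) ∧
      ∃ m > 0, ∀ t, m ≤ w t := by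
  set F₀ := (0 : ℝ) ^ 2 / 2 - (k ^ 2 - c * (Real.cosh 0 ^ 2)⁻¹) * a ^ 2 / 2 +
    a ^ (p + 1) / (p + 1) with hF₀
  have hF₀neg : F₀ < 0 := by
    have h2 : a ^ (p + 1) = a ^ (p - 1) * a ^ 2 := by
      rw [← Real.rpow_natCast a 2, ← Real.rpow_add ha]; congr 1; push_cast; ring
    have h3 : a ^ (p - 1) / (p + 1) < (k ^ 2 - c) / 2 := by
      rw [div_lt_iff₀ (by linarith)]; linarith
    have h4 : F₀ = (a ^ (p - 1) / (p + 1) - (k ^ 2 - c) / 2) * a ^ 2 := by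
      rw [hF₀, h2, Real.cosh_zero]
      ring
    rw [h4]
    exact mul_neg_of_neg_of_pos (by linarith) (by positivity)
  obtain ⟨m, hm, M, hM, hbound⟩ := exists_energy_bounds hk hp hF₀neg
  have hmM : m / 2 ≤ 2 * M := by
    have h := hbound a 0 (k ^ 2 - c * (Real.cosh 0 ^ 2)⁻¹) ha
      (by have : 0 ≤ c * (Real.cosh 0 ^ 2)⁻¹ := by positivity
          linarith) le_rfl
    linarith [h.1, h.2.1]
  set X : ℝ → ℝ := clamp (m / 2) (2 * M)
  set Y : ℝ → ℝ := clamp (-(2 * M)) (2 * M)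
  have hX : ∀ x, X x ∈ Icc (m / 2) (2 * M) := clamp_mem hmM
  have hY : ∀ x, Y x ∈ Icc (-(2 * M)) (2 * M) := clamp_mem (by linarith)
  set q : ℝ → ℝ := fun t => k ^ 2 - c * (Real.cosh t ^ 2)⁻¹ with hq
  have hq0 : ∀ t, |q t| ≤ k ^ 2 := fun t => by
    have h1 : 0 ≤ c * (Real.cosh t ^ 2)⁻¹ := by positivity
    have h2 : c * (Real.cosh t ^ 2)⁻¹ ≤ c := mul_le_of_le_one_right hc (inv_cosh_sq_le_one t)
    rw [abs_le]
    simp only [hq]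
    constructor <;> linarith
  set f : ℝ → ℝ × ℝ → ℝ × ℝ := fun t z => (Y z.2, q t * X z.1 - X z.1 ^ p) with hf
  have hlip : ∀ t, LipschitzWith (Real.toNNReal (1 + (k ^ 2 + p * (2 * M) ^ (p - 1)))) (f t) := by
    intro t
    refine LipschitzWith.of_dist_le_mul fun z z' => ?_
    rw [Real.coe_toNNReal _ (by positivity), Prod.dist_eq, Prod.dist_eq, Real.dist_eq,
      Real.dist_eq, Real.dist_eq, Real.dist_eq]
    set D := max |z.1 - z'.1| |z.2 - z'.2|
    have hD1 : |z.1 - z'.1| ≤ D := le_max_left _ _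
    have hD2 : |z.2 - z'.2| ≤ D := le_max_right _ _
    have hD0 : 0 ≤ D := (abs_nonneg _).trans hD1
    have hP : 0 ≤ k ^ 2 + p * (2 * M) ^ (p - 1) := by positivity
    refine max_le ?_ ?_
    · have := (abs_clamp_sub_clamp_le (-(2 * M)) (2 * M) z.2 z'.2).trans hD2
      change |Y z.2 - Y z'.2| ≤ _
      nlinarith
    · change |q t * X z.1 - X z.1 ^ p - (q t * X z'.1 - X z'.1 ^ p)| ≤ _
      have h1 : |X z.1 - X z'.1| ≤ D := (abs_clamp_sub_clamp_le _ _ _ _).trans hD1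
      have h2 := abs_rpow_sub_rpow_le (p := p) (M := 2 * M) (a := X z.1) (b := X z'.1)
        (by linarith [(hX z.1).1]) (by linarith [(hX z'.1).1]) (hX z.1).2 (hX z'.1).2 hp.le
      have h3 : |q t * (X z.1 - X z'.1)| ≤ k ^ 2 * D := by
        rw [abs_mul]
        exact mul_le_mul (hq0 t) h1 (abs_nonneg _) (sq_nonneg k)
      have h4 : p * (2 * M) ^ (p - 1) * |X z.1 - X z'.1| ≤ p * (2 * M) ^ (p - 1) * D :=
        mul_le_mul_of_nonneg_left h1 (by positivity)
      have h5 : q t * X z.1 - X z.1 ^ p - (q t * X z'.1 - X z'.1 ^ p) =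
          q t * (X z.1 - X z'.1) - (X z.1 ^ p - X z'.1 ^ p) := by ring
      rw [h5]
      refine (abs_sub _ _).trans ?_
      nlinarith
  have hqc : Continuous q := continuous_iff_continuousAt.2 fun t =>
    (((hasDerivAt_inv_cosh_sq t).const_mul c).const_sub (k ^ 2)).continuousAt
  have hcont : ∀ z, Continuous fun t => f t z := fun z => by
    simp only [hf]
    fun_prop
  have hbd : ∀ t z, ‖f t z‖ ≤ Real.toNNReal (2 * M + (k ^ 2 * (2 * M) + (2 * M) ^ p)) := by
    intro t z
    rw [Real.coe_toNNReal _ (by positivity), Prod.norm_def, Real.norm_eq_abs, Real.norm_eq_abs]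
    have hP1 : 0 ≤ k ^ 2 * (2 * M) := by positivity
    have hP2 : 0 ≤ (2 * M) ^ p := by positivity
    refine max_le ?_ ?_
    · have : |Y z.2| ≤ 2 * M := abs_le.2 (hY z.2)
      exact this.trans (by linarith)
    · have hx0 : 0 ≤ X z.1 := by linarith [(hX z.1).1]
      have h1 : |q t * X z.1| ≤ k ^ 2 * (2 * M) := by
        rw [abs_mul, abs_of_nonneg hx0]
        exact mul_le_mul (hq0 t) (hX z.1).2 hx0 (sq_nonneg k)
      have h2 : |X z.1 ^ p| ≤ (2 * M) ^ p := by
        rw [abs_of_nonneg (Real.rpow_nonneg hx0 p)]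
        exact Real.rpow_le_rpow hx0 (hX z.1).2 (by linarith)
      refine (abs_sub _ _).trans ?_
      linarith
  obtain ⟨α, hα0, hα⟩ := exists_forall_hasDerivAt_of_lipschitz_of_bounded hlip hcont hbd (a, 0)
  set x : ℝ → ℝ := fun t => (α t).1 with hxdef
  set y : ℝ → ℝ := fun t => (α t).2 with hydef
  have hx : ∀ t, HasDerivAt x (Y (y t)) t := fun t => (hα t).fst
  have hy : ∀ t, HasDerivAt y (q t * X (x t) - X (x t) ^ p) t := fun t => (hα t).snd
  have hx0 : x 0 = a := by simp [hxdef, hα0]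
  have hy0 : y 0 = 0 := by simp [hydef, hα0]
  have hfwd : ∀ t, 0 ≤ t → m / 2 < x t ∧ x t < 2 * M ∧ |y t| < 2 * M ∧ m ≤ x t := fun t ht =>
    truncated_solution_mem hc hp hm hM hbound hx hy (by rw [hx0]; exact ha)
      (by rw [hx0, hy0]) ht
  -- Time reversal `(x (-t), -y (-t))` preserves the truncated system, since `cosh` is even and the
  -- truncation of `y` is odd.
  have hbwd : ∀ t, 0 ≤ t → m / 2 < x (-t) ∧ x (-t) < 2 * M ∧ |-y (-t)| < 2 * M ∧ m ≤ x (-t) :=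
    fun t ht => by
      refine truncated_solution_mem (x := fun t => x (-t)) (y := fun t => -y (-t)) hc hp hm hM
        hbound (fun s => ?_) (fun s => ?_) (by simpa [hx0] using ha) ?_ ht
      · rw [clamp_neg (by linarith)]
        exact ((hx (-s)).comp s (hasDerivAt_neg s)).congr_deriv (by simp [Y])
      · exact ((hy (-s)).comp s (hasDerivAt_neg s)).neg.congr_deriv (by simp [hq, X])
      · simp only [neg_zero, hx0, hy0]
        exact le_rfl
  have hall : ∀ t, m / 2 < x t ∧ x t < 2 * M ∧ |y t| < 2 * M ∧ m ≤ x t := fun t => by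
    rcases le_total 0 t with ht | ht
    · exact hfwd t ht
    · have := hbwd (-t) (by linarith)
      rwa [neg_neg, abs_neg] at this
  refine ⟨x, y, hx0, fun t => ?_, fun t => ?_, m, hm, fun t => (hall t).2.2.2⟩
  · obtain ⟨-, -, h, -⟩ := hall t
    have := hx t
    rwa [show Y (y t) = y t from clamp_of_mem ⟨(abs_lt.1 h).1.le, (abs_lt.1 h).2.le⟩] at this
  · obtain ⟨h1, h2, -, -⟩ := hall t
    have := hy t
    rwa [show X (x t) = x t from clamp_of_mem ⟨h1.le, h2.le⟩] at this

end EmdenFowler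

/-! ### Singular zonal solutions. -/

section SingularSolutions

theorem artanh_eventuallyEq {s : ℝ} (hs : s ∈ Ioo (-1 : ℝ) 1) :
    Real.artanh =ᶠ[𝓝 s] fun s => 1 / 2 * (Real.log (1 + s) - Real.log (1 - s)) := by
  filter_upwards [isOpen_Ioo.mem_nhds hs] with t ht
  rw [Real.artanh_eq_half_log ⟨ht.1.le, ht.2.le⟩,
    Real.log_div (by linarith [ht.1]) (by linarith [ht.2])]

theorem hasDerivAt_artanh {s : ℝ} (hs : s ∈ Ioo (-1 : ℝ) 1) :
    HasDerivAt Real.artanh (1 / (1 - s ^ 2)) s := by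
  have h1 : (0 : ℝ) < 1 + s := by linarith [hs.1]
  have h2 : (0 : ℝ) < 1 - s := by linarith [hs.2]
  have e1 : HasDerivAt (fun s : ℝ => Real.log (1 + s)) (1 / (1 + s)) s :=
    ((hasDerivAt_id s).const_add 1).log h1.ne'
  have e2 : HasDerivAt (fun s : ℝ => Real.log (1 - s)) (-1 / (1 - s)) s :=
    ((hasDerivAt_id s).const_sub 1).log h2.ne'
  refine (((e1.sub e2).const_mul (1 / 2)).congr_of_eventuallyEq
    (artanh_eventuallyEq hs)).congr_deriv ?_
  have h3 : 1 - s ^ 2 = (1 + s) * (1 - s) := by ring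
  rw [h3]
  field_simp
  ring

theorem contDiffAt_artanh {s : ℝ} (hs : s ∈ Ioo (-1 : ℝ) 1) : ContDiffAt ℝ 2 Real.artanh s := by
  have h1 : (1 : ℝ) + s ≠ 0 := by linarith [hs.1]
  have h2 : (1 : ℝ) - s ≠ 0 := by linarith [hs.2]
  refine ContDiffAt.congr_of_eventuallyEq ?_ (artanh_eventuallyEq hs)
  exact contDiffAt_const.mul (((contDiffAt_const.add contDiffAt_id).log h1).sub
    ((contDiffAt_const.sub contDiffAt_id).log h2))

theorem inv_cosh_artanh_sq {s : ℝ} (hs : s ∈ Ioo (-1 : ℝ) 1) :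
    (Real.cosh (Real.artanh s) ^ 2)⁻¹ = 1 - s ^ 2 := by
  rw [Real.cosh_artanh hs, div_pow, Real.sq_sqrt (one_sub_sq_pos hs).le]
  simp

theorem hasDerivAt_one_sub_sq_rpow {s : ℝ} (hs : s ∈ Ioo (-1 : ℝ) 1) (a : ℝ) :
    HasDerivAt (fun s : ℝ => (1 - s ^ 2) ^ a) (-(2 * a * s) * (1 - s ^ 2) ^ (a - 1)) s := by
  refine ((hasDerivAt_one_sub_sq s).rpow_const (Or.inl (one_sub_sq_pos hs).ne')).congr_deriv ?_
  ring

/-- The function of the height that corresponds to a function `w` of `t = artanh s`. -/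
noncomputable def heightProfile (k : ℝ) (w : ℝ → ℝ) (s : ℝ) : ℝ :=
  (1 - s ^ 2) ^ (-(k / 2)) * w (Real.artanh s)

variable {k : ℝ} {w w' w'' : ℝ → ℝ}

theorem hasDerivAt_heightProfile (hw : ∀ t, HasDerivAt w (w' t) t) {s : ℝ}
    (hs : s ∈ Ioo (-1 : ℝ) 1) :
    HasDerivAt (heightProfile k w)
      ((1 - s ^ 2) ^ (-(k / 2) - 1) * (k * s * w (Real.artanh s) + w' (Real.artanh s))) s := by
  have hσ := one_sub_sq_pos hs
  refine ((hasDerivAt_one_sub_sq_rpow hs (-(k / 2))).mul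
    ((hw _).comp s (hasDerivAt_artanh hs))).congr_deriv ?_
  have h1 : (1 - s ^ 2) ^ (-(k / 2)) = (1 - s ^ 2) ^ (-(k / 2) - 1) * (1 - s ^ 2) := by
    rw [← Real.rpow_add_one hσ.ne']; congr 1; ring
  rw [h1]
  simp only [Function.comp_apply]
  field_simp

theorem hasDerivAt_deriv_heightProfile (hw : ∀ t, HasDerivAt w (w' t) t)
    (hw' : ∀ t, HasDerivAt w' (w'' t) t) {s : ℝ} (hs : s ∈ Ioo (-1 : ℝ) 1) :
    HasDerivAt (fun s => (1 - s ^ 2) ^ (-(k / 2) - 1) *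
        (k * s * w (Real.artanh s) + w' (Real.artanh s)))
      ((1 - s ^ 2) ^ (-(k / 2) - 1) / (1 - s ^ 2) *
        ((k + 2) * s * (k * s * w (Real.artanh s) + w' (Real.artanh s)) +
          k * (1 - s ^ 2) * w (Real.artanh s) + k * s * w' (Real.artanh s) +
          w'' (Real.artanh s))) s := by
  have hσ := one_sub_sq_pos hs
  have e1 : HasDerivAt (fun s => k * s) k s := by simpa using (hasDerivAt_id s).const_mul k
  have e2 := e1.mul ((hw _).comp s (hasDerivAt_artanh hs))
  have e3 := e2.add ((hw' _).comp s (hasDerivAt_artanh hs))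
  refine ((hasDerivAt_one_sub_sq_rpow hs (-(k / 2) - 1)).mul e3).congr_deriv ?_
  have h1 : (1 - s ^ 2) ^ (-(k / 2) - 1 - 1) = (1 - s ^ 2) ^ (-(k / 2) - 1) / (1 - s ^ 2) := by
    rw [Real.rpow_sub_one hσ.ne']
  rw [h1]
  simp only [Function.comp_apply, Pi.add_apply, Pi.mul_apply]
  field_simp
  ring

theorem contDiffOn_heightProfile (hw : ContDiff ℝ 2 w) :
    ContDiffOn ℝ 2 (heightProfile k w) (Ioo (-1) 1) := by
  intro s hs
  refine ContDiffAt.contDiffWithinAt ?_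
  exact ((contDiffAt_const.sub (contDiffAt_id.pow 2)).rpow_const_of_ne
    (one_sub_sq_pos hs).ne').mul (hw.contDiffAt.comp s (contDiffAt_artanh hs))

variable {n : ℕ}

theorem sphereLaplacian_height {f f' : ℝ → ℝ} {f'' : ℝ} (θ : puncturedSphere n)
    (h1 : ∀ s ∈ Ioo (-1 : ℝ) 1, HasDerivAt f (f' s) s)
    (h2 : HasDerivAt f' f'' (inner ℝ (northPole n : EuclideanSpace ℝ (Fin (n + 1)))
      ((θ : Sph n) : EuclideanSpace ℝ (Fin (n + 1))))) :
    sphereLaplacian (fun θ : puncturedSphere n =>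
      f (inner ℝ (northPole n : EuclideanSpace ℝ (Fin (n + 1)))
        ((θ : Sph n) : EuclideanSpace ℝ (Fin (n + 1))))) θ =
      f'' * (1 - inner ℝ (northPole n : EuclideanSpace ℝ (Fin (n + 1)))
        ((θ : Sph n) : EuclideanSpace ℝ (Fin (n + 1))) ^ 2) -
      n * inner ℝ (northPole n : EuclideanSpace ℝ (Fin (n + 1)))
        ((θ : Sph n) : EuclideanSpace ℝ (Fin (n + 1))) *
      f' (inner ℝ (northPole n : EuclideanSpace ℝ (Fin (n + 1)))
        ((θ : Sph n) : EuclideanSpace ℝ (Fin (n + 1)))) := by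
  have hA := (mem_puncturedSphere_iff _).1 θ.2
  have hθ1 : ‖((θ : Sph n) : EuclideanSpace ℝ (Fin (n + 1)))‖ = 1 := norm_eq_of_mem_sphere _
  have hs := inner_northPole_mem_Ioo hA hθ1
  have hev : radialExtension (fun θ : puncturedSphere n =>
      f (inner ℝ (northPole n : EuclideanSpace ℝ (Fin (n + 1)))
        ((θ : Sph n) : EuclideanSpace ℝ (Fin (n + 1))))) =ᶠ[𝓝 (θ : Sph n).1]
      fun y => f (inner ℝ (northPole n : EuclideanSpace ℝ (Fin (n + 1))) y * ‖y‖ ^ (-1 : ℝ)) := by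
    filter_upwards [isOpen_offAxis.mem_nhds hA] with y hy
    rw [radialExtension_eq _ hy]
    simp only [radialProjection, inner_smul_right, Real.rpow_neg_one]
    rw [mul_comm]
  rw [sphereLaplacian, (InnerProductSpace.laplacian_congr_nhds hev).eq_of_nhds,
    laplacian_zonal hθ1 norm_northPole
      (eventually_of_mem (isOpen_Ioo.mem_nhds hs) h1) h2, finrank_euclideanSpace_fin]
  push_cast
  ring

/-- Makes the filter of punctured neighbourhoods of a pole proper; otherwise every limit would exist
vacuously. A pole is approached by normalising `P + t • e` with `e` orthogonal to the axis. -/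
theorem mem_closure_puncturedSphere (hn : 1 ≤ n) (P : Sph n) :
    P ∈ closure (puncturedSphere n : Set (Sph n)) := by
  by_cases hP : P ∈ puncturedSphere n
  · exact subset_closure hP
  obtain ⟨e, he1, heN⟩ := exists_unit_inner_northPole_eq_zero (n := n) hn
  have hPe : inner ℝ e (P : EuclideanSpace ℝ (Fin (n + 1))) = 0 := by
    by_contra h
    exact hP ((mem_puncturedSphere_iff P).2 (mem_offAxis_of_inner_ne_zero he1 heN h))
  have hmem : ∀ t : ℝ, t ≠ 0 → (P : EuclideanSpace ℝ (Fin (n + 1))) + t • e ∈ offAxis n :=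
    fun t ht => mem_offAxis_of_inner_ne_zero he1 heN (by
      rw [inner_add_right, hPe, inner_smul_right, real_inner_self_eq_norm_sq, he1]
      simpa using ht)
  have hP1 : ‖(P : EuclideanSpace ℝ (Fin (n + 1)))‖ = 1 := norm_eq_of_mem_sphere P
  have hlim : Tendsto (fun t : ℝ => ‖(P : EuclideanSpace ℝ (Fin (n + 1))) + t • e‖⁻¹ •
      ((P : EuclideanSpace ℝ (Fin (n + 1))) + t • e)) (𝓝[≠] 0) (𝓝 P) := by
    refine (tendsto_normalize hP1).comp (Tendsto.mono_left ?_ nhdsWithin_le_nhds)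
    have : Continuous fun t : ℝ => (P : EuclideanSpace ℝ (Fin (n + 1))) + t • e := by fun_prop
    simpa using this.tendsto 0
  rw [mem_closure_iff_nhds]
  intro U hU
  rw [nhds_subtype_eq_comap] at hU
  obtain ⟨U', hU', hUU'⟩ := hU
  obtain ⟨t, ht, ht0⟩ := ((hlim.eventually hU').and self_mem_nhdsWithin).exists
  exact ⟨radialProjection _ (hmem t ht0), hUU' ht, (radialProjection _ (hmem t ht0)).2⟩

theorem singularSet_eq_poles (hn : 1 ≤ n) {v : puncturedSphere n → ℝ} (hv : Continuous v)
    {k m : ℝ} (hk : 0 < k) (hm : 0 < m)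
    (hlow : ∀ θ : puncturedSphere n, m * (1 - inner ℝ
      (northPole n : EuclideanSpace ℝ (Fin (n + 1)))
      ((θ : Sph n) : EuclideanSpace ℝ (Fin (n + 1))) ^ 2) ^ (-k) ≤ v θ) :
    singularSet v = {northPole n, southPole n} := by
  ext P
  constructor
  · intro hP
    by_contra hPN
    refine hP ⟨v ⟨P, hPN⟩, ?_⟩
    have h1 : 𝓝 (⟨P, hPN⟩ : puncturedSphere n) =
        comap (fun θ : puncturedSphere n => (θ : Sph n)) (𝓝 P) := nhds_subtype_eq_comap
    rw [← h1]
    exact hv.tendsto ⟨P, hPN⟩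
  · rintro hP ⟨l, hl⟩
    have hne : NeBot (comap (fun θ : puncturedSphere n => (θ : Sph n)) (𝓝 P)) :=
      mem_closure_iff_comap_neBot.1 (mem_closure_puncturedSphere hn P)
    have hcont : Continuous fun Q : Sph n => 1 - inner ℝ
        (northPole n : EuclideanSpace ℝ (Fin (n + 1))) (Q : EuclideanSpace ℝ (Fin (n + 1))) ^ 2 := by
      fun_prop
    have hval : 1 - inner ℝ (northPole n : EuclideanSpace ℝ (Fin (n + 1)))
        (P : EuclideanSpace ℝ (Fin (n + 1))) ^ 2 = 0 := by
      have hself := real_inner_self_eq_norm_sq (northPole n : EuclideanSpace ℝ (Fin (n + 1)))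
      rw [norm_northPole] at hself
      rcases hP with rfl | rfl
      · rw [hself]; norm_num
      · have : ((southPole n : Sph n) : EuclideanSpace ℝ (Fin (n + 1))) = -(northPole n).1 := rfl
        rw [this, inner_neg_right, hself]; norm_num
    have h0 : Tendsto (fun θ : puncturedSphere n => 1 - inner ℝ
        (northPole n : EuclideanSpace ℝ (Fin (n + 1)))
        ((θ : Sph n) : EuclideanSpace ℝ (Fin (n + 1))) ^ 2)
        (comap (fun θ : puncturedSphere n => (θ : Sph n)) (𝓝 P)) (𝓝[>] 0) := by
      refine tendsto_nhdsWithin_iff.2 ⟨?_, Eventually.of_forall fun θ => ?_⟩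
      · have := hcont.tendsto P
        rw [hval] at this
        exact this.comp tendsto_comap
      · exact one_sub_sq_pos (inner_northPole_mem_Ioo ((mem_puncturedSphere_iff _).1 θ.2)
          (norm_eq_of_mem_sphere _))
    have hinf := ((tendsto_rpow_neg_nhdsGT_zero (neg_neg_of_pos hk)).comp h0).const_mul_atTop hm
    exact not_tendsto_nhds_of_tendsto_atTop (tendsto_atTop_mono hlow hinf) l hl

/-- In the variable `t = artanh s` this is the Emden–Fowler equation. Because `k ^ 2 - c = β - k`,
the lower bound on `β` says `c < k ^ 2`, and the bound on `a` says that the initial energy is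
negative. The value on the equator is `w 0`. -/
theorem exists_singular_solution (hn : 3 ≤ n) {β : ℝ} (hβ1 : ((n : ℝ) - 2) / 2 < β)
    (hβ2 : β < (n : ℝ) * ((n : ℝ) - 2) / 4) {a : ℝ} (ha : 0 < a)
    (hap : a ^ (((n : ℝ) + 2) / ((n : ℝ) - 2) - 1) <
      (β - ((n : ℝ) - 2) / 2) * (((n : ℝ) + 2) / ((n : ℝ) - 2) + 1) / 2) :
    ∃ v : puncturedSphere n → ℝ, IsPositiveSolution n β v ∧
      singularSet v = {northPole n, southPole n} ∧
      ∀ θ : puncturedSphere n, inner ℝ (northPole n : EuclideanSpace ℝ (Fin (n + 1)))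
        ((θ : Sph n) : EuclideanSpace ℝ (Fin (n + 1))) = 0 → v θ = a := by
  have hn' : (3 : ℝ) ≤ n := by exact_mod_cast hn
  set k := ((n : ℝ) - 2) / 2 with hk
  set p := ((n : ℝ) + 2) / ((n : ℝ) - 2) with hp
  set c := (n : ℝ) * ((n : ℝ) - 2) / 4 - β with hc
  have hk0 : 0 < k := by rw [hk]; linarith
  have hnk : (n : ℝ) = 2 * k + 2 := by rw [hk]; ring
  have hp1 : 1 < p := by rw [hp, lt_div_iff₀ (by linarith)]; linarith
  have hkp : k * p = k + 2 := by
    have : (n : ℝ) - 2 ≠ 0 := by linarith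
    rw [hk, hp]; field_simp; ring
  have hkc : k ^ 2 - c = β - k := by rw [hc, hnk]; ring
  obtain ⟨w, w', hw0, hw, hw', m, hm, hmw⟩ := exists_emdenFowler_solution hk0
    (show 0 ≤ c by linarith) (by linarith) hp1 ha (by rwa [hkc])
  have hwpos : ∀ t, 0 < w t := fun t => hm.trans_le (hmw t)
  have hwd : deriv w = w' := funext fun t => (hw t).deriv
  have hw'd : deriv w' = fun t => (k ^ 2 - c * (Real.cosh t ^ 2)⁻¹) * w t - w t ^ p :=
    funext fun t => (hw' t).deriv
  have hwc : Continuous w := continuous_iff_continuousAt.2 fun t => (hw t).continuousAt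
  have hw'1 : ContDiff ℝ 1 w' := by
    rw [contDiff_one_iff_deriv, hw'd]
    refine ⟨fun t => (hw' t).differentiableAt, ?_⟩
    have h1 : Continuous fun t => w t ^ p := hwc.rpow_const fun t => Or.inl (hwpos t).ne'
    have h2 : Continuous fun t => (Real.cosh t ^ 2)⁻¹ :=
      (Real.continuous_cosh.pow 2).inv₀ fun t => pow_ne_zero 2 (Real.cosh_pos t).ne'
    fun_prop
  have hw2 : ContDiff ℝ 2 w := by
    rw [show (2 : WithTop ℕ∞) = 1 + 1 by norm_num, contDiff_succ_iff_deriv, hwd]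
    exact ⟨fun t => (hw t).differentiableAt, by simp, hw'1⟩
  set f := heightProfile k w with hf
  have hs : ∀ θ : puncturedSphere n, inner ℝ (northPole n : EuclideanSpace ℝ (Fin (n + 1)))
      ((θ : Sph n) : EuclideanSpace ℝ (Fin (n + 1))) ∈ Ioo (-1 : ℝ) 1 := fun θ =>
    inner_northPole_mem_Ioo ((mem_puncturedSphere_iff _).1 θ.2) (norm_eq_of_mem_sphere _)
  have hC := contMDiff_comp_height (n := n) (contDiffOn_heightProfile (k := k) hw2)
  refine ⟨fun θ => f (inner ℝ (northPole n : EuclideanSpace ℝ (Fin (n + 1)))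
    ((θ : Sph n) : EuclideanSpace ℝ (Fin (n + 1)))), ⟨hC, fun θ => ?_, fun θ => ?_⟩,
    singularSet_eq_poles (k := k / 2) (m := m) (by omega) hC.continuous (by linarith) hm
      fun θ => ?_, fun θ hθ => ?_⟩
  · exact mul_pos (Real.rpow_pos_of_pos (one_sub_sq_pos (hs θ)) _) (hwpos _)
  · rw [sphereLaplacian_height θ (fun s hs => hasDerivAt_heightProfile hw hs)
      (hasDerivAt_deriv_heightProfile hw hw' (hs θ))]
    have hsθ := hs θ
    set s := inner ℝ (northPole n : EuclideanSpace ℝ (Fin (n + 1)))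
      ((θ : Sph n) : EuclideanSpace ℝ (Fin (n + 1)))
    have hσ := one_sub_sq_pos hsθ
    have h1 : (1 - s ^ 2) ^ (-(k / 2)) = (1 - s ^ 2) ^ (-(k / 2) - 1) * (1 - s ^ 2) := by
      rw [← Real.rpow_add_one hσ.ne']; congr 1; ring
    have h2 : f s ^ p = (1 - s ^ 2) ^ (-(k / 2) - 1) * w (Real.artanh s) ^ p := by
      rw [hf, heightProfile, Real.mul_rpow (Real.rpow_nonneg hσ.le _) (hwpos _).le,
        ← Real.rpow_mul hσ.le]
      congr 2
      linarith
    have h3 : f s = (1 - s ^ 2) ^ (-(k / 2) - 1) * (1 - s ^ 2) * w (Real.artanh s) := by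
      rw [hf, heightProfile, h1]
    rw [inv_cosh_artanh_sq hsθ, h2, h3, hnk]
    have hβ : β = k ^ 2 + k - c := by linarith
    rw [hβ]
    field_simp
    ring
  · rw [hf, heightProfile, mul_comm]
    exact mul_le_mul_of_nonneg_left (hmw _) (Real.rpow_nonneg (one_sub_sq_pos (hs θ)).le _)
  · simp [hf, heightProfile, hθ, hw0]

theorem infinite_singular_solutions (hn : 3 ≤ n) {β : ℝ} (hβ1 : ((n : ℝ) - 2) / 2 < β)
    (hβ2 : β < (n : ℝ) * ((n : ℝ) - 2) / 4) :
    {v : puncturedSphere n → ℝ | IsPositiveSolution n β v ∧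
      singularSet v = {northPole n, southPole n}}.Infinite := by
  have hn' : (3 : ℝ) ≤ n := by exact_mod_cast hn
  set p := ((n : ℝ) + 2) / ((n : ℝ) - 2) with hp
  have hp1 : 1 < p := by rw [hp, lt_div_iff₀ (by linarith)]; linarith
  set Q := (β - ((n : ℝ) - 2) / 2) * (p + 1) / 2
  have hQ : 0 < Q := by
    have : 0 < β - ((n : ℝ) - 2) / 2 := by linarith
    positivity
  -- For positive `a`, the smallness condition `a ^ (p - 1) < Q` amounts to `a < a₀`.
  set a₀ := Q ^ (p - 1)⁻¹
  have ha₀ : 0 < a₀ := by positivity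
  have hex : ∀ a : Ioo (0 : ℝ) a₀, ∃ v : puncturedSphere n → ℝ, IsPositiveSolution n β v ∧
      singularSet v = {northPole n, southPole n} ∧
      ∀ θ : puncturedSphere n, inner ℝ (northPole n : EuclideanSpace ℝ (Fin (n + 1)))
        ((θ : Sph n) : EuclideanSpace ℝ (Fin (n + 1))) = 0 → v θ = a := fun a => by
    refine exists_singular_solution hn hβ1 hβ2 a.2.1 ?_
    have h1 := Real.rpow_lt_rpow a.2.1.le a.2.2 (show 0 < p - 1 by linarith)
    rwa [Real.rpow_inv_rpow hQ.le (by linarith)] at h1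
  choose v hv1 hv2 hv3 using hex
  obtain ⟨e, he1, heN⟩ := exists_unit_inner_northPole_eq_zero (n := n) (by omega)
  have heA : e ∈ offAxis n := mem_offAxis_of_inner_eq_zero (by rintro rfl; simp at he1) heN
  have hθ : inner ℝ (northPole n : EuclideanSpace ℝ (Fin (n + 1)))
      (((radialProjection e heA : puncturedSphere n) : Sph n) :
        EuclideanSpace ℝ (Fin (n + 1))) = 0 := by
    simp [radialProjection, inner_smul_right, heN]
  have : Infinite (Ioo (0 : ℝ) a₀) := (Ioo_infinite ha₀).to_subtype
  refine Set.infinite_of_injective_forall_mem (f := v) (fun a b hab => ?_)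
    fun a => ⟨hv1 a, hv2 a⟩
  have := congrFun hab (radialProjection e heA)
  rw [hv3 a _ hθ, hv3 b _ hθ] at this
  exact Subtype.ext this

end SingularSolutions

theorem corollary1p4 (n : ℕ) (hn : 3 ≤ n) (β : ℝ) :
    (β < (n : ℝ) * ((n : ℝ) - 2) / 4 →
      ∀ v : puncturedSphere n → ℝ, IsPositiveSolution n β v → IsRotationallySymmetric v) ∧
    (β ≤ 0 → ¬ ∃ v : puncturedSphere n → ℝ, IsPositiveSolution n β v) ∧
    (((n : ℝ) - 2) / 2 < β → β < (n : ℝ) * ((n : ℝ) - 2) / 4 →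
      {v : puncturedSphere n → ℝ | IsPositiveSolution n β v ∧
        singularSet v = {northPole n, southPole n}}.Infinite) :=
  ⟨fun hβ _ hv => hv.isRotationallySymmetric hn hβ,
    fun hβ ⟨v, hv⟩ => not_isPositiveSolution_of_nonpos hn hβ v hv,
    fun hβ1 hβ2 => infinite_singular_solutions hn hβ1 hβ2⟩
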